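/- Consider the linear model $Y = X\beta + \epsilon$ with $X \in \mathbb{R}^{n\times p}$, $\beta\in\mathbb{R}^p$, $\epsilon\in\mathbb{R}^n$, where $p \ge 1$. Let $S_0 = \{j : \beta_j \ne 0\}$, $k = |S_0|$ (possibly $k=0$), and let $\bar k$ be an integer with $\bar k \ge \max\{k,1\}$. Assume that the entries $X_{\ell j}$ are independent random variables with $\mathbb{E}e^{tX_{\ell j}} \le e^{t^2/2}$ for all $t\in\mathbb{R}$, that $\epsilon$ is independent of $X$, and that its entries are independent with $\mathbb{E}e^{t\epsilon_\ell}\le e^{\sigma^2t^2/2}$ for all $t\in\mathbb{R}$, where $\sigma>0$. (The entries need not be identically distributed.) Let $a > 0$ and $\tau = \sqrt{2(1+a)\log p}$. Let $\hat S$ be the output of Orthogonal Matching Pursuit on $(Y,X)$ with threshold $\tau$: starting from $d=\emptyset$, put $R_d = (I-\mathcal{P}_d)Y$, where $\mathcal{P}_d$ is the orthogonal projection onto the span of the columns $X_j$, $j\in d$, and $\mathcal{Z}_{j} = X_j^{T}R_d/\|R_d\|$ for $j \notin d$ (with $\mathcal{Z}_j = 0$ if $R_d = 0$); if $\max_{j\notin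 d}|\mathcal{Z}_j| > \tau$, add to $d$ an index attaining this maximum (if there are several, one chosen by a fixed deterministic rule depending only on the set of maximizing indices) and repeat; otherwise stop and output $\hat S = d$. Let $\lambda_{\max}\ge\lambda_{\min}>0$ and $\lambda>0$, and let $\mathcal{E}_{cond}$ be the event that at least one of the following two conditions fails: 1. $\lambda_{\min}\|v\|^2 \le \|X_{S_0}v\|^2/n \le \lambda_{\max}\|v\|^2$ for all $v\in\mathbb{R}^{k}$, where $X_{S_0}$ is the submatrix of the columns of $X$ with index in $S_0$; 2. $\|\epsilon\|^2/n \le \sigma^2\lambda$. Define $$r_1 = \frac{\max\{\lambda_{\max},\lambda\}}{\lambda_{\min}^3},\quad r_2 = \frac{1}{\sqrt{\lambda_{\min}}}+\sqrt{r_1},\quad \bar\xi = 32\,r_2^2(1+a),\quad r = 2r_2\sqrt{1+a},\quad \mu_n = \sqrt{\frac{2\log p}{n}},$$ $$P_{err}(k) = \mathbb{P}(\mathcal{E}_{cond}) + \frac{2(k+1)}{p^a} + \frac{2k}{p^{1+a}}\quad (k\ge1),\qquad P_{err}(0) = \frac{2}{p^a}.$$ Suppose $n \ge \bar\xi\,\bar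 k\log p$. If $k\ge 1$, then with probability at least $1-P_{err}(k)$ one has both $$\hat S\subseteq S_0\quad\text{and}\quad \{j : |\beta_j| > r\sigma\sqrt{k}\,\mu_n\}\subseteq\hat S .$$ If moreover $|\beta_j|\ge\beta_{\min}$ for all $j\in S_0$, where $\beta_{\min}>0$ satisfies $\beta_{\min} > r\sigma\mu_n$, then $\hat S = S_0$ with probability at least $1-P_{err}(k)$. If $k=0$, then $\hat S=\emptyset$ with probability at least $1-P_{err}(0)$. -/

import Mathlib

open MeasureTheory ProbabilityTheory

noncomputable section

/-- The `j`-th column of the design matrix, as a vector of Euclidean space. -/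
def designCol {n p : ℕ} (X : Matrix (Fin n) (Fin p) ℝ) (j : Fin p) : EuclideanSpace ℝ (Fin n) :=
  WithLp.toLp 2 (fun i => X i j)

/-- The response `Y = X β + ε` of the linear model. -/
def response {n p : ℕ} (X : Matrix (Fin n) (Fin p) ℝ) (β : Fin p → ℝ)
    (ε : EuclideanSpace ℝ (Fin n)) : EuclideanSpace ℝ (Fin n) :=
  WithLp.toLp 2 (X.mulVec β) + ε

/-- The support `S₀(β) = {j : β_j ≠ 0}`. -/
def trueSupport {p : ℕ} (β : Fin p → ℝ) : Finset (Fin p) :=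
  Finset.univ.filter (fun j => β j ≠ 0)

/-! ### Orthogonal matching pursuit -/

/-- The residual `(I - P_d) Y`, where `P_d` is the orthogonal projection onto the span of the
columns of `X` with index in `d`. -/
def ompResidual {n p : ℕ} (X : Matrix (Fin n) (Fin p) ℝ) (Y : EuclideanSpace ℝ (Fin n))
    (d : Finset (Fin p)) : EuclideanSpace ℝ (Fin n) :=
  Y - (Submodule.span ℝ (designCol X '' (d : Set (Fin p)))).starProjection Y

/-- The statistic `X_jᵀ R / ‖R‖`, where `R` is the residual for the detected set `d`.
It is `0` if `R = 0`. -/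
def ompStat {n p : ℕ} (X : Matrix (Fin n) (Fin p) ℝ) (Y : EuclideanSpace ℝ (Fin n))
    (d : Finset (Fin p)) (j : Fin p) : ℝ :=
  inner ℝ (designCol X j) (ompResidual X Y d) / ‖ompResidual X Y d‖

open scoped Classical in
/-- The set of all maximizers of `|ompStat X Y d j|` over the indices `j` outside `d`. -/
def ompArgmax {n p : ℕ} (X : Matrix (Fin n) (Fin p) ℝ) (Y : EuclideanSpace ℝ (Fin n))
    (d : Finset (Fin p)) : Finset (Fin p) :=
  (dᶜ).filter (fun j => ∀ i ∈ dᶜ, |ompStat X Y d i| ≤ |ompStat X Y d j|)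

open scoped Classical in
/-- One step of the algorithm with threshold `τ`: if some undetected index has a statistic above
the threshold, a maximizing index is added, ties being broken by the rule `sel`; otherwise the
detected set no longer changes (the algorithm has stopped). -/
def ompStep {n p : ℕ} (sel : Finset (Fin p) → Fin p) (X : Matrix (Fin n) (Fin p) ℝ)
    (Y : EuclideanSpace ℝ (Fin n)) (τ : ℝ) (d : Finset (Fin p)) : Finset (Fin p) :=
  if ∃ j ∈ dᶜ, τ < |ompStat X Y d j| then insert (sel (ompArgmax X Y d)) d else d

/-- The output `Ŝ(Y, X, τ)` of orthogonal matching pursuit. Every step before the algorithm stops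
detects one new index out of `p`, so it has stopped after at most `p` steps; see
`ompSupport_stopped`. -/
def ompSupport {n p : ℕ} (sel : Finset (Fin p) → Fin p) (X : Matrix (Fin n) (Fin p) ℝ)
    (Y : EuclideanSpace ℝ (Fin n)) (τ : ℝ) : Finset (Fin p) :=
  (ompStep sel X Y τ)^[p] ∅

theorem ompArgmax_nonempty {n p : ℕ} (X : Matrix (Fin n) (Fin p) ℝ)
    (Y : EuclideanSpace ℝ (Fin n)) (d : Finset (Fin p)) (hd : (dᶜ).Nonempty) :
    (ompArgmax X Y d).Nonempty := by
  obtain ⟨j, hj, hmax⟩ := Finset.exists_max_image dᶜ (fun j => |ompStat X Y d j|) hd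
  exact ⟨j, by simpa [ompArgmax] using ⟨by simpa using hj, fun i hi => hmax i (by simpa using hi)⟩⟩

/-- The output of the algorithm meets the stopping criterion. -/
theorem ompSupport_stopped {n p : ℕ} (sel : Finset (Fin p) → Fin p)
    (hsel : ∀ s : Finset (Fin p), s.Nonempty → sel s ∈ s) (X : Matrix (Fin n) (Fin p) ℝ)
    (Y : EuclideanSpace ℝ (Fin n)) (τ : ℝ) (j : Fin p) (hj : j ∉ ompSupport sel X Y τ) :
    |ompStat X Y (ompSupport sel X Y τ) j| ≤ τ := by
  classical
  have key : ∀ m : ℕ, (∀ j ∉ (ompStep sel X Y τ)^[m] ∅,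
      |ompStat X Y ((ompStep sel X Y τ)^[m] ∅) j| ≤ τ) ∨ ((ompStep sel X Y τ)^[m] ∅).card = m := by
    intro m
    induction m with
    | zero => right; simp
    | succ m ih =>
      rw [Function.iterate_succ_apply']
      set d := (ompStep sel X Y τ)^[m] ∅
      by_cases h : ∃ j ∈ dᶜ, τ < |ompStat X Y d j|
      · right
        have hc : d.card = m := by
          rcases ih with ih | ih
          · obtain ⟨j, hj, hlt⟩ := h
            exact absurd (ih j (by simpa using hj)) (not_le.mpr hlt)
          · exact ih
        have hm := hsel _ (ompArgmax_nonempty X Y d (h.imp fun _ hj => hj.1))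
        have hnot : sel (ompArgmax X Y d) ∉ d := by
          simpa using (Finset.mem_filter.mp hm).1
        rw [ompStep, if_pos h, Finset.card_insert_of_notMem hnot, hc]
      · left
        rw [ompStep, if_neg h]
        intro j hj
        by_contra hlt
        exact h ⟨j, by simpa using hj, not_le.mp hlt⟩
  rcases key p with h | h
  · exact h j hj
  · have : ompSupport sel X Y τ = Finset.univ := by
      rw [← Finset.card_eq_iff_eq_univ]; simpa [ompSupport] using h
    exact absurd (Finset.mem_univ j) (this ▸ hj)

/-! ### The conditions and the constants -/

/-- Condition 1: `λ_min ‖v‖² ≤ ‖X_S v‖² / n ≤ λ_max ‖v‖²` for every vector `v` indexed by `S`. -/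
def EigenCondition {n p : ℕ} (X : Matrix (Fin n) (Fin p) ℝ) (S : Finset (Fin p))
    (lmin lmax : ℝ) : Prop :=
  ∀ v : EuclideanSpace ℝ S,
    lmin * ‖v‖ ^ 2 ≤ ‖∑ j : S, v j • designCol X j‖ ^ 2 / n ∧
      ‖∑ j : S, v j • designCol X j‖ ^ 2 / n ≤ lmax * ‖v‖ ^ 2

/-- Condition 2: `‖ε‖² / n ≤ σ² λ`. -/
def NoiseCondition {n : ℕ} (ε : EuclideanSpace ℝ (Fin n)) (σ lam : ℝ) : Prop :=
  ‖ε‖ ^ 2 / n ≤ σ ^ 2 * lam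

/-- `r₁ = max {λ_max, λ} / λ_min³`. -/
def ratioOne (lmin lmax lam : ℝ) : ℝ := max lmax lam / lmin ^ 3

/-- `r₂ = 1 / √λ_min + √r₁`. -/
def ratioTwo (lmin lmax lam : ℝ) : ℝ := 1 / √lmin + √(ratioOne lmin lmax lam)

/-- `μ_n = √(2 log p / n)`. -/
def noiseLevel (n p : ℕ) : ℝ := √(2 * Real.log p / n)

/-- The threshold `τ = √(2 (1 + a) log p)`. -/
def ompThreshold (a : ℝ) (p : ℕ) : ℝ := √(2 * (1 + a) * Real.log p)

/-- The bound `P_err(k)` on the probability of failure; `pcond` is the probability that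
Condition 1 or Condition 2 fails. -/
def errProb (pcond a : ℝ) (p k : ℕ) : ℝ :=
  if k = 0 then 2 / (p : ℝ) ^ a
  else pcond + 2 * (k + 1) / (p : ℝ) ^ a + 2 * k / (p : ℝ) ^ (1 + a)

end

/-!
The columns outside the true support `S` are independent of the columns in `S` and of the noise.
Running the algorithm on the design with all other columns set to zero (`restrictCols`) therefore
gives a path of detected subsets of `S` whose residuals are independent of every column outside
`S`. The path has at most `k + 1` distinct residuals (`ompPath_restrictCols_eq_of_card_le`), and the
normalized inner product of such a column with each of them is sub-Gaussian with parameter `1`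
(`measureReal_lt_abs_inner_le`). A union bound shows that, off an event of probability
`2 (k + 1) / p ^ a`, no column outside `S` ever exceeds the threshold, in which case the algorithm
on the full design follows the same path (`ompSupport_subset_of_restrictCols`). The residuals are
measurable because adding an index changes the residual by the Gram-Schmidt formula
`ompResidual_insert`.

Suppose now that the algorithm has stopped at `d ⊆ S`, and let `ξ` be the least-squares coefficients
of the noise on the columns in `S`, `γ = β + ξ` and `u = S \ d`. The residual `f` of `∑_S γ_j X_j`
has the same inner products with the columns in `S` as the full residual `R`, so the stopping
criterion gives `‖f‖² = ∑_u γ_j ⟨X_j, R⟩ ≤ √|u| ‖γ_u‖ τ ‖R‖`, while the eigenvalue condition gives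
`‖f‖² ≥ n λ_min ‖γ_u‖²` and `‖R‖ ≤ ‖f‖ + ‖ε‖`. The sample size turns this into a bound for `γ` on `u`
in root mean square (`sum_sq_le_of_stopped`). Each `ξ_j` is the inner product of `ε` with the
normalized residual of `X_j` on the other columns of `S`, divided by the length of that residual,
which is at least `√(n λ_min)` (`abs_coeff_le_of_abs_inner_le`); this costs an event of probability
`2 k / p ^ (1 + a)`.

The resulting bound is below the required signal strength when `λ_min ≤ 9/4`
(`missed_coeff_bound_le`). For larger `λ_min` the eigenvalue condition would force a column of
squared length more than `9 n / 4`, although its entries are sub-Gaussian with parameter `1`; this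
has probability at most `1 / p ^ a` (`measureReal_eigenCondition_le`), so the claimed lower bound on
the probability is not positive.
-/

/-! ### Residuals and the deterministic error bound -/

noncomputable section

variable {n p : ℕ}

theorem ompResidual_inner_of_mem (X : Matrix (Fin n) (Fin p) ℝ) (Y : EuclideanSpace ℝ (Fin n))
    {d : Finset (Fin p)} {w : EuclideanSpace ℝ (Fin n)}
    (hw : w ∈ Submodule.span ℝ (designCol X '' (d : Set (Fin p)))) :
    inner ℝ (ompResidual X Y d) w = 0 :=
  Submodule.starProjection_inner_eq_zero _ _ hw

theorem designCol_mem_span (X : Matrix (Fin n) (Fin p) ℝ) {d : Finset (Fin p)} {j : Fin p}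
    (hj : j ∈ d) : designCol X j ∈ Submodule.span ℝ (designCol X '' (d : Set (Fin p))) :=
  Submodule.subset_span ⟨j, hj, rfl⟩

theorem ompResidual_eq_of_mem_of_inner_eq_zero (X : Matrix (Fin n) (Fin p) ℝ)
    (Y : EuclideanSpace ℝ (Fin n)) (d : Finset (Fin p)) (v : EuclideanSpace ℝ (Fin n))
    (hv : v ∈ Submodule.span ℝ (designCol X '' (d : Set (Fin p))))
    (ho : ∀ w ∈ Submodule.span ℝ (designCol X '' (d : Set (Fin p))), inner ℝ (Y - v) w = 0) :
    ompResidual X Y d = Y - v := by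
  rw [ompResidual, Submodule.eq_starProjection_of_mem_of_inner_eq_zero hv ho]

/-- The Gram-Schmidt update of the residual. It remains valid when `X_j` lies in the span of the
columns in `d`: then the correction vanishes, because division by zero gives zero. -/
theorem ompResidual_insert (X : Matrix (Fin n) (Fin p) ℝ) (Y : EuclideanSpace ℝ (Fin n))
    (d : Finset (Fin p)) (j : Fin p) :
    ompResidual X Y (insert j d) = ompResidual X Y d -
      (inner ℝ (ompResidual X (designCol X j) d) (ompResidual X Y d) /
        ‖ompResidual X (designCol X j) d‖ ^ 2) • ompResidual X (designCol X j) d := by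
  set U := Submodule.span ℝ (designCol X '' (d : Set (Fin p)))
  set e := ompResidual X (designCol X j) d with he
  set c := inner ℝ e (ompResidual X Y d) / ‖e‖ ^ 2 with hc
  have hspan : Submodule.span ℝ (designCol X '' ((insert j d : Finset (Fin p)) : Set (Fin p))) =
      Submodule.span ℝ {designCol X j} ⊔ U := by
    rw [Finset.coe_insert, Set.image_insert_eq, Submodule.span_insert]
  have hUle : U ≤ Submodule.span ℝ {designCol X j} ⊔ U := le_sup_right
  have hj : designCol X j ∈ Submodule.span ℝ {designCol X j} ⊔ U :=
    Submodule.mem_sup_left (Submodule.mem_span_singleton_self _)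
  have hemem : e ∈ Submodule.span ℝ {designCol X j} ⊔ U :=
    Submodule.sub_mem _ hj (hUle (Submodule.starProjection_apply_mem _ _))
  have heU : ∀ w ∈ U, inner ℝ e w = 0 := fun w hw => ompResidual_inner_of_mem X _ hw
  have key := ompResidual_eq_of_mem_of_inner_eq_zero X Y (insert j d)
    (U.starProjection Y + c • e)
    (by
      rw [hspan]
      exact Submodule.add_mem _ (hUle (Submodule.starProjection_apply_mem _ _))
        (Submodule.smul_mem _ _ hemem))
    (by
      rw [hspan]
      have hsub : Y - (U.starProjection Y + c • e) = ompResidual X Y d - c • e := by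
        rw [ompResidual]; abel
      rw [hsub]
      have h1 : ∀ w ∈ U, inner ℝ (ompResidual X Y d - c • e) w = 0 := by
        intro w hw
        rw [inner_sub_left, inner_smul_left, heU w hw, ompResidual_inner_of_mem X Y hw]
        simp
      have h2 : inner ℝ (ompResidual X Y d - c • e) (designCol X j) = 0 := by
        have hsplit : designCol X j = e + U.starProjection (designCol X j) := by
          rw [he, ompResidual]; abel
        rw [hsplit, inner_add_right, h1 _ (Submodule.starProjection_apply_mem _ _), add_zero,
          inner_sub_left, inner_smul_left, real_inner_self_eq_norm_sq, real_inner_comm]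
        by_cases h0 : e = 0
        · simp [h0]
        · have : ‖e‖ ^ 2 ≠ 0 := by simpa using h0
          simp [hc, this]
      intro w hw
      obtain ⟨x, hx, y, hy, rfl⟩ := Submodule.mem_sup.mp hw
      obtain ⟨t, rfl⟩ := Submodule.mem_span_singleton.mp hx
      rw [inner_add_right, inner_smul_right, h2, h1 y hy]
      simp)
  rw [key, ompResidual]
  abel

theorem norm_ompResidual_le (X : Matrix (Fin n) (Fin p) ℝ) (Y : EuclideanSpace ℝ (Fin n))
    (d : Finset (Fin p)) : ‖ompResidual X Y d‖ ≤ ‖Y‖ := by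
  rw [ompResidual, ← Submodule.starProjection_orthogonal_val]
  exact Submodule.norm_starProjection_apply_le _ _

theorem ompResidual_sub (X : Matrix (Fin n) (Fin p) ℝ) (Y Z : EuclideanSpace ℝ (Fin n))
    (d : Finset (Fin p)) : ompResidual X (Y - Z) d = ompResidual X Y d - ompResidual X Z d := by
  simp only [ompResidual, map_sub]; abel

/-- The residual depends on the columns with index in `d` only. -/
theorem ompResidual_congr {X X' : Matrix (Fin n) (Fin p) ℝ} (Y : EuclideanSpace ℝ (Fin n))
    {d : Finset (Fin p)} (h : ∀ j ∈ d, designCol X j = designCol X' j) :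
    ompResidual X Y d = ompResidual X' Y d := by
  have : designCol X '' (d : Set (Fin p)) = designCol X' '' (d : Set (Fin p)) :=
    Set.image_congr fun j hj => h j hj
  simp only [ompResidual, this]

theorem exists_sum_eq_of_mem_span_designCol (X : Matrix (Fin n) (Fin p) ℝ) (d : Finset (Fin p))
    {w : EuclideanSpace ℝ (Fin n)}
    (hw : w ∈ Submodule.span ℝ (designCol X '' (d : Set (Fin p)))) :
    ∃ c : Fin p → ℝ, ∑ j ∈ d, c j • designCol X j = w := by
  obtain ⟨c, hc⟩ := (Submodule.mem_span_image_finset_iff_exists_fun ℝ).mp hw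
  refine ⟨fun j => if h : j ∈ d then c ⟨j, h⟩ else 0, ?_⟩
  rw [← hc, ← Finset.sum_coe_sort]
  refine Finset.sum_congr rfl fun j _ => ?_
  simp

theorem response_eq_sum (X : Matrix (Fin n) (Fin p) ℝ) (β : Fin p → ℝ)
    (ε : EuclideanSpace ℝ (Fin n)) :
    response X β ε = ∑ j ∈ trueSupport β, β j • designCol X j + ε := by
  have h : ∑ j ∈ trueSupport β, β j • designCol X j = ∑ j, β j • designCol X j := by
    apply Finset.sum_subset (Finset.subset_univ _)
    intro j _ hj
    have : β j = 0 := by simpa [trueSupport] using hj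
    simp [this]
  rw [h, response]
  congr 1
  ext i
  simp [Matrix.mulVec, dotProduct, designCol, mul_comm]

/-- The lower eigenvalue bound, for coefficient vectors given on all indices. -/
theorem EigenCondition.le_norm_sq_sum {X : Matrix (Fin n) (Fin p) ℝ} {S : Finset (Fin p)}
    {lmin lmax : ℝ} (h : EigenCondition X S lmin lmax) (hn : 0 < n) (c : Fin p → ℝ) :
    n * lmin * ∑ j ∈ S, c j ^ 2 ≤ ‖∑ j ∈ S, c j • designCol X j‖ ^ 2 := by
  have h1 := (h (WithLp.toLp 2 fun j : S => c j)).1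
  rw [EuclideanSpace.norm_sq_eq] at h1
  have hn' : (0 : ℝ) < n := by exact_mod_cast hn
  rw [le_div_iff₀ hn'] at h1
  simp only [Real.norm_eq_abs, sq_abs] at h1
  rw [Finset.sum_coe_sort S (fun j => c j ^ 2),
    Finset.sum_coe_sort S (fun j => c j • designCol X j)] at h1
  linarith

/-- The residual of a column on the other columns of `S` is not shorter than `√(n λ_min)`. -/
theorem EigenCondition.le_norm_sq_residual {X : Matrix (Fin n) (Fin p) ℝ} {S : Finset (Fin p)}
    {lmin lmax : ℝ} (h : EigenCondition X S lmin lmax) (hl : 0 ≤ lmin) (hn : 0 < n) {j : Fin p}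
    (hj : j ∈ S) : n * lmin ≤ ‖ompResidual X (designCol X j) (S.erase j)‖ ^ 2 := by
  obtain ⟨c, hc⟩ := exists_sum_eq_of_mem_span_designCol X (S.erase j)
    (Submodule.starProjection_apply_mem
      (Submodule.span ℝ (designCol X '' ((S.erase j : Finset (Fin p)) : Set (Fin p))))
      (designCol X j))
  have h1 := h.le_norm_sq_sum hn (fun i => if i = j then 1 else -c i)
  have h2 : ∑ i ∈ S, (if i = j then (1 : ℝ) else -c i) • designCol X i =
      ompResidual X (designCol X j) (S.erase j) := by
    rw [← Finset.add_sum_erase S _ hj, ompResidual, ← hc, if_pos rfl, one_smul, sub_eq_add_neg,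
      ← Finset.sum_neg_distrib]
    congr 1
    refine Finset.sum_congr rfl fun i hi => ?_
    rw [if_neg (Finset.ne_of_mem_erase hi), neg_smul]
  rw [h2] at h1
  have h3 : (1 : ℝ) ≤ ∑ i ∈ S, (if i = j then (1 : ℝ) else -c i) ^ 2 := by
    have := Finset.single_le_sum (f := fun i => (if i = j then (1 : ℝ) else -c i) ^ 2)
      (fun i _ => sq_nonneg _) hj
    simpa using this
  have h4 : (0 : ℝ) ≤ n * lmin := by positivity
  nlinarith

theorem abs_inner_le_of_abs_ompStat_le {X : Matrix (Fin n) (Fin p) ℝ}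
    {Y : EuclideanSpace ℝ (Fin n)} {d : Finset (Fin p)} {j : Fin p} {τ : ℝ}
    (h : |ompStat X Y d j| ≤ τ) :
    |inner ℝ (designCol X j) (ompResidual X Y d)| ≤ τ * ‖ompResidual X Y d‖ := by
  by_cases h0 : ompResidual X Y d = 0
  · simp [h0]
  · rw [ompStat, abs_div, abs_norm] at h
    exact (div_le_iff₀ (norm_pos_iff.mpr h0)).mp h

/-- Least-squares coefficient `j` of the noise is the inner product of the noise with the residual
`R_j` of `X_j` on the other columns, divided by `‖R_j‖²`; hence it is small when the normalized
inner product is. -/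
theorem abs_coeff_le_of_abs_inner_le {X : Matrix (Fin n) (Fin p) ℝ} {S : Finset (Fin p)}
    {lmin lmax t : ℝ} (h : EigenCondition X S lmin lmax) (hl : 0 < lmin) (hn : 0 < n)
    {ε : EuclideanSpace ℝ (Fin n)} {ξ : Fin p → ℝ}
    (hξ : ∑ j ∈ S, ξ j • designCol X j =
      (Submodule.span ℝ (designCol X '' (S : Set (Fin p)))).starProjection ε)
    {j : Fin p} (hj : j ∈ S)
    (ht : |inner ℝ ((‖ompResidual X (designCol X j) (S.erase j)‖)⁻¹ •
      ompResidual X (designCol X j) (S.erase j)) ε| ≤ t) :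
    |ξ j| ≤ t / √(n * lmin) := by
  set R := ompResidual X (designCol X j) (S.erase j) with hR
  have hnl : (0 : ℝ) < n * lmin := by positivity
  have hRsq := h.le_norm_sq_residual hl.le hn hj
  have hRle : √(n * lmin) ≤ ‖R‖ := Real.sqrt_le_iff.mpr ⟨norm_nonneg _, hRsq⟩
  have hsqrt : 0 < √(n * lmin) := Real.sqrt_pos.mpr hnl
  have hRpos : 0 < ‖R‖ := hsqrt.trans_le hRle
  have hcol : inner ℝ R (designCol X j) = ‖R‖ ^ 2 := by
    have : designCol X j = R + (Submodule.span ℝ (designCol X ''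
        ((S.erase j : Finset (Fin p)) : Set (Fin p)))).starProjection (designCol X j) := by
      rw [hR, ompResidual]; abel
    rw [this, inner_add_right, real_inner_self_eq_norm_sq, hR,
      ompResidual_inner_of_mem X _ (Submodule.starProjection_apply_mem _ _), add_zero]
  have hRS : R ∈ Submodule.span ℝ (designCol X '' (S : Set (Fin p))) :=
    Submodule.sub_mem _ (designCol_mem_span X hj)
      (Submodule.span_mono (Set.image_mono (by simp))
        (Submodule.starProjection_apply_mem _ _))
  have hRε : inner ℝ R ε = ξ j * ‖R‖ ^ 2 := by
    have h1 : inner ℝ R ε = inner ℝ R (∑ j ∈ S, ξ j • designCol X j) := by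
      have := Submodule.starProjection_inner_eq_zero ε R hRS
      rw [inner_sub_left, sub_eq_zero] at this
      rw [hξ, real_inner_comm, this, real_inner_comm]
    rw [h1, inner_sum, ← Finset.add_sum_erase S _ hj, inner_smul_right, hcol,
      Finset.sum_eq_zero, add_zero]
    intro i hi
    rw [inner_smul_right, hR, ompResidual_inner_of_mem X _ (designCol_mem_span X hi), mul_zero]
  rw [inner_smul_left, hRε] at ht
  have h2 : |ξ j| * ‖R‖ ≤ t := by
    convert ht using 1
    simp only [conj_trivial]
    rw [show ‖R‖⁻¹ * (ξ j * ‖R‖ ^ 2) = ξ j * ‖R‖ by field_simp, abs_mul, abs_norm]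
  rw [le_div_iff₀ hsqrt]
  exact (mul_le_mul_of_nonneg_left hRle (abs_nonneg _)).trans h2

/-- When the algorithm has stopped at `d ⊆ S`, the coefficients of the missed columns, perturbed by
the least-squares coefficients `ξ` of the noise, are small in mean square. -/
theorem sum_sq_le_of_stopped {X : Matrix (Fin n) (Fin p) ℝ} {β : Fin p → ℝ}
    {lmin lmax lam σ τ : ℝ} (hE : EigenCondition X (trueSupport β) lmin lmax) (hl : 0 < lmin)
    (hn : 0 < n) (hσ : 0 < σ) (hlam : 0 < lam) (hτ : 0 ≤ τ)
    {ε : EuclideanSpace ℝ (Fin n)} (hN : NoiseCondition ε σ lam) {ξ : Fin p → ℝ}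
    (hξ : ∑ j ∈ trueSupport β, ξ j • designCol X j =
      (Submodule.span ℝ (designCol X '' (trueSupport β : Set (Fin p)))).starProjection ε)
    {d : Finset (Fin p)} (hd : d ⊆ trueSupport β)
    (hsmall : 16 * (((trueSupport β).card : ℝ) * τ ^ 2) ≤ n * lmin)
    (hcrit : ∀ j ∈ trueSupport β \ d, |ompStat X (response X β ε) d j| ≤ τ) :
    ∑ j ∈ trueSupport β \ d, (β j + ξ j) ^ 2 ≤
      ((trueSupport β \ d).card : ℝ) * (4 / 3 * (τ * σ * √lam / (lmin * √n))) ^ 2 := by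
  set S := trueSupport β
  set Y := response X β ε with hY
  set u := S \ d
  set g := ∑ j ∈ S, (β j + ξ j) • designCol X j with hg
  set R := ompResidual X Y d with hR
  set f := ompResidual X g d with hf
  have hn' : (0 : ℝ) < n := by exact_mod_cast hn
  have hnl : (0 : ℝ) < n * lmin := by positivity
  have hYg : Y - g = ompResidual X ε S := by
    rw [hY, response_eq_sum, hg, ompResidual, ← hξ]
    simp only [add_smul, Finset.sum_add_distrib]
    abel
  have hRf : R - f = ompResidual X (ompResidual X ε S) d := by
    rw [hR, hf, ← ompResidual_sub, hYg]
  -- the part of the residual outside the span of the true columns is at most the noise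
  have hRnorm : ‖R‖ ≤ ‖f‖ + σ * √(n * lam) := by
    have h1 : ‖R - f‖ ≤ ‖ε‖ := by
      rw [hRf]
      exact (norm_ompResidual_le _ _ _).trans (norm_ompResidual_le _ _ _)
    have h2 : ‖ε‖ ≤ σ * √(n * lam) := by
      rw [NoiseCondition, div_le_iff₀ hn'] at hN
      apply le_of_sq_le_sq _ (by positivity)
      rw [mul_pow, Real.sq_sqrt (by positivity)]
      linarith
    calc ‖R‖ = ‖f + (R - f)‖ := by congr 1; abel
      _ ≤ ‖f‖ + ‖R - f‖ := norm_add_le _ _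
      _ ≤ _ := by linarith
  have hinner : ∀ j ∈ S, inner ℝ (designCol X j) f = inner ℝ (designCol X j) R := by
    intro j hj
    have : R = f + (R - f) := by abel
    rw [this, inner_add_right, hRf, real_inner_comm (ompResidual X (ompResidual X ε S) d)]
    rw [ompResidual, inner_sub_left, ompResidual_inner_of_mem X ε (designCol_mem_span X hj),
      real_inner_comm]
    rw [Submodule.inner_starProjection_left_eq_right,
      ompResidual_inner_of_mem X ε
        (Submodule.span_mono (Set.image_mono hd) (Submodule.starProjection_apply_mem _ _))]
    simp
  obtain ⟨c, hc⟩ := exists_sum_eq_of_mem_span_designCol X d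
    (Submodule.starProjection_apply_mem
      (Submodule.span ℝ (designCol X '' (d : Set (Fin p)))) g)
  have hsplit : ∀ F : Fin p → EuclideanSpace ℝ (Fin n),
      ∑ j ∈ S, F j = ∑ j ∈ u, F j + ∑ j ∈ d, F j := fun F => (Finset.sum_sdiff hd).symm
  -- `f` is a combination of the true columns whose coefficients on `u` are `β + ξ`
  have hfsum : f = ∑ j ∈ S, (if j ∈ d then β j + ξ j - c j else β j + ξ j) • designCol X j := by
    have h1 : f = g - ∑ j ∈ d, c j • designCol X j := by rw [hf, ompResidual, hc]
    rw [h1, hg, hsplit, hsplit, add_sub_assoc, ← Finset.sum_sub_distrib]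
    congr 1
    · refine Finset.sum_congr rfl fun j hj => ?_
      rw [if_neg (Finset.mem_sdiff.mp hj).2]
    · refine Finset.sum_congr rfl fun j hj => ?_
      rw [if_pos hj, sub_smul (β j + ξ j)]
  set G := ∑ j ∈ u, (β j + ξ j) ^ 2
  have hGnn : 0 ≤ G := Finset.sum_nonneg fun j _ => sq_nonneg _
  have hlow : n * lmin * G ≤ ‖f‖ ^ 2 := by
    refine le_trans ?_ (hfsum ▸ hE.le_norm_sq_sum hn _)
    refine mul_le_mul_of_nonneg_left ?_ hnl.le
    rw [← Finset.sum_sdiff hd]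
    have : G = ∑ j ∈ S \ d, (if j ∈ d then β j + ξ j - c j else β j + ξ j) ^ 2 := by
      refine Finset.sum_congr rfl fun j hj => ?_
      rw [if_neg (Finset.mem_sdiff.mp hj).2]
    rw [this]
    exact le_add_of_nonneg_right (Finset.sum_nonneg fun j _ => sq_nonneg _)
  set m : ℝ := (u.card : ℝ) with hm
  have hmnn : 0 ≤ m := Nat.cast_nonneg _
  clear_value m
  have hup : ‖f‖ ^ 2 ≤ √m * √G * (τ * ‖R‖) := by
    have h1 : ‖f‖ ^ 2 = ∑ j ∈ u, (β j + ξ j) * inner ℝ (designCol X j) R := by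
      have h2 : inner ℝ g f = ‖f‖ ^ 2 := by
        have : g = f + (Submodule.span ℝ (designCol X '' (d : Set (Fin p)))).starProjection g := by
          rw [hf, ompResidual]; abel
        rw [this, inner_add_left, real_inner_self_eq_norm_sq,
          real_inner_comm, hf,
          ompResidual_inner_of_mem X g (Submodule.starProjection_apply_mem _ _), add_zero]
      rw [← h2, hg, hsplit, inner_add_left, sum_inner, sum_inner]
      rw [Finset.sum_eq_zero (s := d), add_zero]
      · refine Finset.sum_congr rfl fun j hj => ?_
        rw [inner_smul_left, hinner j (Finset.mem_sdiff.mp hj).1]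
        simp
      · intro j hj
        rw [inner_smul_left, real_inner_comm, hf,
          ompResidual_inner_of_mem X g (designCol_mem_span X hj), mul_zero]
    have h3 : ∑ j ∈ u, (β j + ξ j) * inner ℝ (designCol X j) R ≤
        (∑ j ∈ u, |β j + ξ j|) * (τ * ‖R‖) := by
      rw [Finset.sum_mul]
      refine Finset.sum_le_sum fun j hj => ?_
      refine (le_abs_self _).trans ?_
      rw [abs_mul]
      exact mul_le_mul_of_nonneg_left (abs_inner_le_of_abs_ompStat_le (hcrit j hj))
        (abs_nonneg _)
    have h4 : ∑ j ∈ u, |β j + ξ j| ≤ √m * √G := by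
      rw [← Real.sqrt_mul (by positivity)]
      apply Real.le_sqrt_of_sq_le
      have := sq_sum_le_card_mul_sum_sq (s := u) (f := fun j => |β j + ξ j|)
      simpa only [sq_abs, ← hm] using this
    rw [h1]
    exact h3.trans (mul_le_mul_of_nonneg_right h4 (by positivity))
  have hcard : m ≤ S.card := by
    rw [hm]
    exact_mod_cast Finset.card_le_card Finset.sdiff_subset
  -- with `A = ‖f‖` and `θ = √|u| τ / √(n λ_min) ≤ 1/4` this reads `A ≤ θ (A + σ √(n λ))`
  set N := √(n * lmin)
  have hNpos : 0 < N := Real.sqrt_pos.mpr hnl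
  have hNsq : N ^ 2 = n * lmin := Real.sq_sqrt hnl.le
  have hGN : √G * N ≤ ‖f‖ := by
    rw [← Real.sqrt_mul hGnn]
    exact Real.sqrt_le_iff.mpr ⟨norm_nonneg _, by linarith⟩
  set q := √m * τ with hq
  have hqnn : 0 ≤ q := by positivity
  have hqN : 4 * q ≤ N := by
    apply Real.le_sqrt_of_sq_le
    rw [hq, mul_pow, mul_pow, Real.sq_sqrt (by positivity)]
    nlinarith [sq_nonneg τ]
  have hfN : ‖f‖ * N ≤ q * ‖R‖ := by
    by_cases hf0 : ‖f‖ = 0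
    · rw [hf0, zero_mul]; positivity
    · have hfpos : 0 < ‖f‖ := lt_of_le_of_ne (norm_nonneg _) (Ne.symm hf0)
      refine le_of_mul_le_mul_left ?_ hfpos
      calc ‖f‖ * (‖f‖ * N) = ‖f‖ ^ 2 * N := by ring
        _ ≤ √m * √G * (τ * ‖R‖) * N := mul_le_mul_of_nonneg_right hup hNpos.le
        _ = (√G * N) * (q * ‖R‖) := by rw [hq]; ring
        _ ≤ ‖f‖ * (q * ‖R‖) := mul_le_mul_of_nonneg_right hGN (by positivity)
  have hM : 3 / 4 * (‖f‖ * N) ≤ q * (σ * √(n * lam)) := by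
    have h1 := mul_le_mul_of_nonneg_left hRnorm hqnn
    have h2 := mul_le_mul_of_nonneg_right hqN (norm_nonneg f)
    nlinarith
  have hfin : √G * (n * lmin) ≤ 4 / 3 * (q * (σ * √(n * lam))) := by
    have h1 := mul_le_mul_of_nonneg_right hGN hNpos.le
    rw [mul_assoc, ← sq, hNsq] at h1
    linarith
  have hroot : √G ≤ √m * (4 / 3 * (τ * σ * √lam / (lmin * √n))) := by
    have hsn : 0 < √(n : ℝ) := Real.sqrt_pos.mpr hn'
    rw [Real.sqrt_mul hn'.le, ← Real.mul_self_sqrt hn'.le, Real.sqrt_mul_self (Real.sqrt_nonneg _),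
      hq] at hfin
    have h5 : √G * (lmin * √n) ≤ √m * (4 / 3 * (τ * σ * √lam)) := by
      refine le_of_mul_le_mul_right ?_ hsn
      linarith
    calc √G ≤ √m * (4 / 3 * (τ * σ * √lam)) / (lmin * √n) :=
          (le_div_iff₀ (by positivity)).mpr h5
      _ = _ := by ring
  calc G = √G ^ 2 := (Real.sq_sqrt hGnn).symm
    _ ≤ (√m * (4 / 3 * (τ * σ * √lam / (lmin * √n)))) ^ 2 :=
        pow_le_pow_left₀ (Real.sqrt_nonneg _) hroot 2
    _ = _ := by rw [mul_pow, Real.sq_sqrt (by positivity)]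

end

/-! ### The path of the algorithm on the columns in a set -/

noncomputable section

variable {n p : ℕ}

/-- The design with the columns outside `S` replaced by zero. -/
def restrictCols (S : Finset (Fin p)) (X : Matrix (Fin n) (Fin p) ℝ) :
    Matrix (Fin n) (Fin p) ℝ :=
  fun i j => if j ∈ S then X i j else 0

theorem designCol_restrictCols_of_mem {S : Finset (Fin p)} (X : Matrix (Fin n) (Fin p) ℝ)
    {j : Fin p} (hj : j ∈ S) : designCol (restrictCols S X) j = designCol X j := by
  ext i; simp [designCol, restrictCols, hj]

theorem designCol_restrictCols_of_notMem {S : Finset (Fin p)} (X : Matrix (Fin n) (Fin p) ℝ)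
    {j : Fin p} (hj : j ∉ S) : designCol (restrictCols S X) j = 0 := by
  ext i; simp [designCol, restrictCols, hj]

theorem response_restrictCols (X : Matrix (Fin n) (Fin p) ℝ) (β : Fin p → ℝ)
    (ε : EuclideanSpace ℝ (Fin n)) :
    response (restrictCols (trueSupport β) X) β ε = response X β ε := by
  rw [response_eq_sum, response_eq_sum]
  congr 1
  exact Finset.sum_congr rfl fun j hj => by rw [designCol_restrictCols_of_mem X hj]

theorem ompResidual_restrictCols {S d : Finset (Fin p)} (hd : d ⊆ S)
    (X : Matrix (Fin n) (Fin p) ℝ) (Y : EuclideanSpace ℝ (Fin n)) :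
    ompResidual (restrictCols S X) Y d = ompResidual X Y d :=
  ompResidual_congr Y fun _ hj => designCol_restrictCols_of_mem X (hd hj)

theorem ompStat_restrictCols_of_mem {S d : Finset (Fin p)} (hd : d ⊆ S)
    (X : Matrix (Fin n) (Fin p) ℝ) (Y : EuclideanSpace ℝ (Fin n)) {j : Fin p} (hj : j ∈ S) :
    ompStat (restrictCols S X) Y d j = ompStat X Y d j := by
  rw [ompStat, ompStat, ompResidual_restrictCols hd, designCol_restrictCols_of_mem X hj]

theorem ompStat_restrictCols_of_notMem {S d : Finset (Fin p)}
    (X : Matrix (Fin n) (Fin p) ℝ) (Y : EuclideanSpace ℝ (Fin n)) {j : Fin p} (hj : j ∉ S) :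
    ompStat (restrictCols S X) Y d j = 0 := by
  rw [ompStat, designCol_restrictCols_of_notMem X hj, inner_zero_left, zero_div]

theorem mem_ompArgmax {X : Matrix (Fin n) (Fin p) ℝ} {Y : EuclideanSpace ℝ (Fin n)}
    {d : Finset (Fin p)} {j : Fin p} :
    j ∈ ompArgmax X Y d ↔ j ∉ d ∧ ∀ i ∉ d, |ompStat X Y d i| ≤ |ompStat X Y d j| := by
  simp [ompArgmax]

/-- When every statistic outside `S` is at most the threshold, a step of the algorithm does the
same on the full design as on the columns in `S` alone. -/
theorem ompStep_restrictCols {S d : Finset (Fin p)} (hd : d ⊆ S) (sel : Finset (Fin p) → Fin p)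
    (X : Matrix (Fin n) (Fin p) ℝ) (Y : EuclideanSpace ℝ (Fin n)) {τ : ℝ} (hτ : 0 ≤ τ)
    (h : ∀ j ∉ S, |ompStat X Y d j| ≤ τ) :
    ompStep sel X Y τ d = ompStep sel (restrictCols S X) Y τ d := by
  have hle : ∀ j ∉ S, |ompStat (restrictCols S X) Y d j| ≤ τ := fun j hj => by
    rwa [ompStat_restrictCols_of_notMem X Y hj, abs_zero]
  have hiff : (∃ j ∈ dᶜ, τ < |ompStat X Y d j|) ↔
      ∃ j ∈ dᶜ, τ < |ompStat (restrictCols S X) Y d j| := by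
    refine exists_congr fun j => and_congr_right fun _ => ?_
    by_cases hj : j ∈ S
    · rw [ompStat_restrictCols_of_mem hd X Y hj]
    · exact iff_of_false (not_lt.mpr (h j hj)) (not_lt.mpr (hle j hj))
  by_cases hex : ∃ j ∈ dᶜ, τ < |ompStat X Y d j|
  · rw [ompStep, ompStep, if_pos hex, if_pos (hiff.mp hex)]
    obtain ⟨l, hl, hlt⟩ := hex
    have hl' : l ∉ d := by simpa using hl
    have hlS : l ∈ S := by
      by_contra hc
      exact absurd (h l hc) (not_le.mpr hlt)
    congr 2
    ext j
    rw [mem_ompArgmax, mem_ompArgmax]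
    refine and_congr_right fun _ => ?_
    by_cases hj : j ∈ S
    · rw [ompStat_restrictCols_of_mem hd X Y hj]
      constructor
      · intro hmax i hi
        by_cases hiS : i ∈ S
        · rw [ompStat_restrictCols_of_mem hd X Y hiS]; exact hmax i hi
        · rw [ompStat_restrictCols_of_notMem X Y hiS, abs_zero]; exact abs_nonneg _
      · intro hmax i hi
        by_cases hiS : i ∈ S
        · have := hmax i hi
          rwa [ompStat_restrictCols_of_mem hd X Y hiS] at this
        · have := hmax l hl'
          rw [ompStat_restrictCols_of_mem hd X Y hlS] at this
          exact (h i hiS).trans (hlt.le.trans this)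
    · refine iff_of_false (fun hmax => ?_) (fun hmax => ?_)
      · exact absurd ((hmax l hl').trans (h j hj)) (not_le.mpr hlt)
      · have := (hmax l hl').trans (hle j hj)
        rw [ompStat_restrictCols_of_mem hd X Y hlS] at this
        exact absurd this (not_le.mpr hlt)
  · rw [ompStep, ompStep, if_neg hex, if_neg (hiff.not.mp hex)]

/-- The set detected after `m` steps of the algorithm. -/
def ompPath (sel : Finset (Fin p) → Fin p) (X : Matrix (Fin n) (Fin p) ℝ)
    (Y : EuclideanSpace ℝ (Fin n)) (τ : ℝ) (m : ℕ) : Finset (Fin p) :=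
  (ompStep sel X Y τ)^[m] ∅

theorem ompPath_succ (sel : Finset (Fin p) → Fin p) (X : Matrix (Fin n) (Fin p) ℝ)
    (Y : EuclideanSpace ℝ (Fin n)) (τ : ℝ) (m : ℕ) :
    ompPath sel X Y τ (m + 1) = ompStep sel X Y τ (ompPath sel X Y τ m) :=
  Function.iterate_succ_apply' _ _ _

/-- Run on the columns in `S` alone, the algorithm detects only indices in `S`. -/
theorem ompPath_restrictCols_subset {sel : Finset (Fin p) → Fin p}
    (hsel : ∀ s : Finset (Fin p), s.Nonempty → sel s ∈ s) (S : Finset (Fin p))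
    (X : Matrix (Fin n) (Fin p) ℝ) (Y : EuclideanSpace ℝ (Fin n)) {τ : ℝ} (hτ : 0 ≤ τ) (m : ℕ) :
    ompPath sel (restrictCols S X) Y τ m ⊆ S := by
  induction m with
  | zero => simp [ompPath]
  | succ m ih =>
    rw [ompPath_succ]
    set d := ompPath sel (restrictCols S X) Y τ m
    rw [ompStep]
    split_ifs with hex
    · refine Finset.insert_subset ?_ ih
      have hmem := mem_ompArgmax.mp (hsel _ (ompArgmax_nonempty (restrictCols S X) Y d
        (hex.imp fun _ h => h.1)))
      obtain ⟨l, hl, hlt⟩ := hex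
      by_contra hc
      have := hmem.2 l (by simpa using hl)
      rw [ompStat_restrictCols_of_notMem X Y hc, abs_zero] at this
      linarith
    · exact ih

/-- Until the algorithm stops, every step detects a new index. -/
theorem ompPath_succ_eq_or_card {sel : Finset (Fin p) → Fin p}
    (hsel : ∀ s : Finset (Fin p), s.Nonempty → sel s ∈ s)
    (X : Matrix (Fin n) (Fin p) ℝ) (Y : EuclideanSpace ℝ (Fin n)) (τ : ℝ) (m : ℕ) :
    ompPath sel X Y τ (m + 1) = ompPath sel X Y τ m ∨ (ompPath sel X Y τ (m + 1)).card = m + 1 := by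
  have hstep : ∀ d : Finset (Fin p), ompStep sel X Y τ d = d ∨
      (ompStep sel X Y τ d).card = d.card + 1 := by
    intro d
    rw [ompStep]
    split_ifs with hex
    · right
      have hmem := mem_ompArgmax.mp (hsel _ (ompArgmax_nonempty X Y d (hex.imp fun _ h => h.1)))
      rw [Finset.card_insert_of_notMem hmem.1]
    · exact Or.inl rfl
  induction m with
  | zero =>
    rcases hstep (ompPath sel X Y τ 0) with h | h
    · left; rw [ompPath_succ, h]
    · right; rw [ompPath_succ, h]; simp [ompPath]
  | succ m ih =>
    rcases ih with h | h
    · left; rw [ompPath_succ, h, ← ompPath_succ, h]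
    · rcases hstep (ompPath sel X Y τ (m + 1)) with h' | h'
      · left; rw [ompPath_succ, h']
      · right; rw [ompPath_succ, h', h]

/-- Run on the columns in `S` alone, the algorithm stops after at most `|S|` steps. -/
theorem ompPath_restrictCols_eq_of_card_le {sel : Finset (Fin p) → Fin p}
    (hsel : ∀ s : Finset (Fin p), s.Nonempty → sel s ∈ s) (S : Finset (Fin p))
    (X : Matrix (Fin n) (Fin p) ℝ) (Y : EuclideanSpace ℝ (Fin n)) {τ : ℝ} (hτ : 0 ≤ τ) {m : ℕ}
    (hm : S.card ≤ m) :
    ompPath sel (restrictCols S X) Y τ m = ompPath sel (restrictCols S X) Y τ S.card := by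
  induction m, hm using Nat.le_induction with
  | base => rfl
  | succ m hm ih =>
    rw [← ih]
    refine (ompPath_succ_eq_or_card hsel _ Y τ m).resolve_right fun h => ?_
    have := Finset.card_le_card (ompPath_restrictCols_subset hsel S X Y hτ (m + 1))
    omega

/-- If along the path on the columns in `S` no statistic outside `S` exceeds the threshold, then
the algorithm on the full design detects only indices in `S`. -/
theorem ompSupport_subset_of_restrictCols {sel : Finset (Fin p) → Fin p}
    (hsel : ∀ s : Finset (Fin p), s.Nonempty → sel s ∈ s) (S : Finset (Fin p))
    (X : Matrix (Fin n) (Fin p) ℝ) (Y : EuclideanSpace ℝ (Fin n)) {τ : ℝ} (hτ : 0 ≤ τ)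
    (h : ∀ m ≤ S.card, ∀ j ∉ S,
      |ompStat X Y (ompPath sel (restrictCols S X) Y τ m) j| ≤ τ) :
    ompSupport sel X Y τ ⊆ S := by
  have key : ∀ m, ompPath sel X Y τ m = ompPath sel (restrictCols S X) Y τ m := by
    intro m
    induction m with
    | zero => simp [ompPath]
    | succ m ih =>
      rw [ompPath_succ, ompPath_succ, ih]
      refine ompStep_restrictCols (ompPath_restrictCols_subset hsel S X Y hτ m) sel X Y hτ ?_
      rcases le_total m S.card with hm | hm
      · exact h m hm
      · rw [ompPath_restrictCols_eq_of_card_le hsel S X Y hτ hm]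
        exact h _ le_rfl
  have hpath : ompSupport sel X Y τ = ompPath sel X Y τ p := by rw [ompSupport, ompPath]
  rw [hpath, key p]
  exact ompPath_restrictCols_subset hsel S X Y hτ p

/-! ### Measurability of the path -/

section Measurability

variable {α : Type*} [MeasurableSpace α]

theorem measurable_toLp_of_coord {f : α → Fin n → ℝ} (hf : ∀ i, Measurable fun x => f x i) :
    Measurable fun x => (WithLp.toLp 2 (f x) : EuclideanSpace ℝ (Fin n)) :=
  (WithLp.measurable_toLp 2 _).comp (measurable_pi_lambda _ hf)

theorem measurable_designCol {X : α → Matrix (Fin n) (Fin p) ℝ}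
    (hX : ∀ i j, Measurable fun x => X x i j) (j : Fin p) :
    Measurable fun x => designCol (X x) j :=
  measurable_toLp_of_coord fun i => hX i j

theorem measurable_ompResidual {X : α → Matrix (Fin n) (Fin p) ℝ}
    (hX : ∀ i j, Measurable fun x => X x i j) (d : Finset (Fin p)) :
    ∀ {Y : α → EuclideanSpace ℝ (Fin n)}, Measurable Y →
      Measurable fun x => ompResidual (X x) (Y x) d := by
  induction d using Finset.induction_on with
  | empty =>
    intro Y hY
    simpa [ompResidual] using hY
  | insert j d _ ih =>
    intro Y hY
    simp only [ompResidual_insert]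
    have h1 := ih (measurable_designCol hX j)
    have h2 := ih hY
    exact h2.sub (((h1.inner h2).div (h1.norm.pow_const 2)).smul h1)

theorem measurable_ompStat {X : α → Matrix (Fin n) (Fin p) ℝ}
    (hX : ∀ i j, Measurable fun x => X x i j) {Y : α → EuclideanSpace ℝ (Fin n)}
    (hY : Measurable Y) (d : Finset (Fin p)) (j : Fin p) :
    Measurable fun x => ompStat (X x) (Y x) d j :=
  ((measurable_designCol hX j).inner (measurable_ompResidual hX d hY)).div
    (measurable_ompResidual hX d hY).norm

theorem measurableSet_ompArgmax_eq {X : α → Matrix (Fin n) (Fin p) ℝ}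
    (hX : ∀ i j, Measurable fun x => X x i j) {Y : α → EuclideanSpace ℝ (Fin n)}
    (hY : Measurable Y) (d s : Finset (Fin p)) :
    MeasurableSet {x | ompArgmax (X x) (Y x) d = s} := by
  have h : {x | ompArgmax (X x) (Y x) d = s} = ⋂ j, {x | (j ∉ d ∧ ∀ i ∉ d,
      |ompStat (X x) (Y x) d i| ≤ |ompStat (X x) (Y x) d j|) ↔ j ∈ s} := by
    ext x
    simp only [Set.mem_ofPred_eq, Set.mem_iInter, Finset.ext_iff, mem_ompArgmax]
  rw [h]
  have habs : ∀ i, Measurable fun x => |ompStat (X x) (Y x) d i| :=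
    fun i => (measurable_ompStat hX hY d i).abs
  refine MeasurableSet.iInter fun j => measurableSet_setOfPred.mpr ?_
  refine Measurable.iff (Measurable.and measurable_const ?_) measurable_const
  refine Measurable.forall fun i => Measurable.imp measurable_const ?_
  exact measurableSet_setOfPred.mp (measurableSet_le (habs i) (habs j))

theorem measurableSet_ompStep_eq (sel : Finset (Fin p) → Fin p)
    {X : α → Matrix (Fin n) (Fin p) ℝ}
    (hX : ∀ i j, Measurable fun x => X x i j) {Y : α → EuclideanSpace ℝ (Fin n)}
    (hY : Measurable Y) (τ : ℝ) (d s : Finset (Fin p)) :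
    MeasurableSet {x | ompStep sel (X x) (Y x) τ d = s} := by
  have h : {x | ompStep sel (X x) (Y x) τ d = s} =
      {x | ((∃ j, j ∈ dᶜ ∧ τ < |ompStat (X x) (Y x) d j|) ∧
          ∃ t : Finset (Fin p), ompArgmax (X x) (Y x) d = t ∧ insert (sel t) d = s) ∨
        ((¬ ∃ j, j ∈ dᶜ ∧ τ < |ompStat (X x) (Y x) d j|) ∧ d = s)} := by
    ext x
    simp only [Set.mem_ofPred_eq, ompStep]
    by_cases hex : ∃ j, j ∈ dᶜ ∧ τ < |ompStat (X x) (Y x) d j|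
    · simp only [hex, if_true, true_and, not_true, false_and, or_false, exists_eq_left']
    · simp only [hex, if_false, not_false_iff, true_and, false_and, false_or]
  rw [h]
  have hex : Measurable fun x => ∃ j, j ∈ dᶜ ∧ τ < |ompStat (X x) (Y x) d j| :=
    Measurable.exists fun j => Measurable.and measurable_const (measurableSet_setOfPred.mp
      (measurableSet_lt measurable_const (measurable_ompStat hX hY d j).abs))
  refine measurableSet_setOfPred.mpr (Measurable.or (hex.and (Measurable.exists fun t => ?_))
    (hex.not.and measurable_const))
  exact (measurableSet_setOfPred.mp (measurableSet_ompArgmax_eq hX hY d t)).and measurable_const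

theorem measurableSet_ompPath_eq (sel : Finset (Fin p) → Fin p)
    {X : α → Matrix (Fin n) (Fin p) ℝ}
    (hX : ∀ i j, Measurable fun x => X x i j) {Y : α → EuclideanSpace ℝ (Fin n)}
    (hY : Measurable Y) (τ : ℝ) (m : ℕ) (s : Finset (Fin p)) :
    MeasurableSet {x | ompPath sel (X x) (Y x) τ m = s} := by
  induction m generalizing s with
  | zero => exact MeasurableSet.const (∅ = s)
  | succ m ih =>
    have h : {x | ompPath sel (X x) (Y x) τ (m + 1) = s} =
        {x | ∃ d, ompPath sel (X x) (Y x) τ m = d ∧ ompStep sel (X x) (Y x) τ d = s} := by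
      ext x
      simp [ompPath_succ]
    rw [h]
    exact measurableSet_setOfPred.mpr (Measurable.exists fun d =>
      (measurableSet_setOfPred.mp (ih d)).and
      (measurableSet_setOfPred.mp (measurableSet_ompStep_eq sel hX hY τ d s)))

/-- The residual along the path is measurable: the path takes finitely many values, each on a
measurable set. -/
theorem measurable_ompResidual_ompPath (sel : Finset (Fin p) → Fin p)
    {X : α → Matrix (Fin n) (Fin p) ℝ}
    (hX : ∀ i j, Measurable fun x => X x i j) {Y : α → EuclideanSpace ℝ (Fin n)}
    (hY : Measurable Y) (τ : ℝ) (m : ℕ) :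
    Measurable fun x => ompResidual (X x) (Y x) (ompPath sel (X x) (Y x) τ m) := by
  intro B hB
  have h : (fun x => ompResidual (X x) (Y x) (ompPath sel (X x) (Y x) τ m)) ⁻¹' B =
      {x | ∃ d, ompPath sel (X x) (Y x) τ m = d ∧ ompResidual (X x) (Y x) d ∈ B} := by
    ext x
    simp
  rw [h]
  exact measurableSet_setOfPred.mpr (Measurable.exists fun d =>
    (measurableSet_setOfPred.mp (measurableSet_ompPath_eq sel hX hY τ m d)).and
      (measurableSet_setOfPred.mp (measurable_ompResidual hX d hY hB)))

end Measurability

end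

/-! ### Sub-Gaussian tail bounds -/

noncomputable section

variable {Ω : Type*} [MeasurableSpace Ω] {P : Measure Ω}

/-- Independence can be regrouped: if `f` is independent of `g`, and `(f, g)` of `h`, then `f` is
independent of `(g, h)`. -/
theorem IndepFun.prodMk_right_of_prodMk_left {A B C : Type*} [MeasurableSpace A]
    [MeasurableSpace B] [MeasurableSpace C] [IsProbabilityMeasure P] {f : Ω → A} {g : Ω → B}
    {h : Ω → C} (hf : Measurable f) (hg : Measurable g) (hh : Measurable h)
    (hfg : IndepFun f g P) (hfgh : IndepFun (fun ω => (f ω, g ω)) h P) :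
    IndepFun f (fun ω => (g ω, h ω)) P := by
  have hgh : IndepFun g h P := hfgh.comp measurable_snd measurable_id
  have := Measure.isProbabilityMeasure_map (μ := P) hf.aemeasurable
  have := Measure.isProbabilityMeasure_map (μ := P) hg.aemeasurable
  have := Measure.isProbabilityMeasure_map (μ := P) hh.aemeasurable
  rw [indepFun_iff_map_prod_eq_prod_map_map hf.aemeasurable (hg.prodMk hh).aemeasurable,
    hgh.map_prod_eq_prod_map_map hg.aemeasurable hh.aemeasurable, ← Measure.prodAssoc_prod,
    ← hfg.map_prod_eq_prod_map_map hf.aemeasurable hg.aemeasurable,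
    ← hfgh.map_prod_eq_prod_map_map (hf.prodMk hg).aemeasurable hh.aemeasurable,
    Measure.map_map MeasurableEquiv.prodAssoc.measurable ((hf.prodMk hg).prodMk hh)]
  rfl

theorem HasSubgaussianMGF.of_le {Z : Ω → ℝ} {c c' : NNReal} (h : HasSubgaussianMGF Z c P)
    (hc : c ≤ c') : HasSubgaussianMGF Z c' P where
  integrable_exp_mul := h.integrable_exp_mul
  mgf_le t := by
    refine (h.mgf_le t).trans (Real.exp_le_exp.mpr ?_)
    have : (c : ℝ) ≤ c' := hc
    gcongr

theorem measureReal_lt_abs_le_of_hasSubgaussianMGF [IsProbabilityMeasure P] {Z : Ω → ℝ}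
    {c : NNReal} (h : HasSubgaussianMGF Z c P) {t : ℝ} (ht : 0 ≤ t) :
    P.real {ω | t < |Z ω|} ≤ 2 * Real.exp (-t ^ 2 / (2 * c)) := by
  have h1 := h.measure_ge_le ht
  have h2 := h.neg.measure_ge_le ht
  have hsub : {ω | t < |Z ω|} ⊆ {ω | t ≤ Z ω} ∪ {ω | t ≤ (-Z) ω} := by
    intro ω hω
    have hω' : t < |Z ω| := hω
    rcases lt_abs.mp hω' with h | h
    · exact Or.inl h.le
    · exact Or.inr h.le
  calc P.real {ω | t < |Z ω|} ≤ P.real ({ω | t ≤ Z ω} ∪ {ω | t ≤ (-Z) ω}) := measureReal_mono hsub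
    _ ≤ _ := measureReal_union_le _ _
    _ ≤ _ := by linarith

theorem hasSubgaussianMGF_inner {n : ℕ} {V : Ω → EuclideanSpace ℝ (Fin n)} {c : NNReal}
    (hindep : iIndepFun (fun i ω => V ω i) P) (hsub : ∀ i, HasSubgaussianMGF (fun ω => V ω i) c P)
    (w : EuclideanSpace ℝ (Fin n)) (hw : ‖w‖ ≤ 1) :
    HasSubgaussianMGF (fun ω => inner ℝ w (V ω)) c P := by
  have h := HasSubgaussianMGF.sum_of_iIndepFun (s := Finset.univ)
    (hindep.comp (fun i x => w i * x) (fun i => measurable_const_mul (w i)))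
    (fun i _ => (hsub i).const_mul (w i))
  refine HasSubgaussianMGF.of_le (h.congr (Filter.Eventually.of_forall fun ω => ?_)) ?_
  · simp [PiLp.inner_apply, mul_comm]
  · change ∑ i, NNReal.mk (w i ^ 2) (sq_nonneg _) * c ≤ c
    rw [← Finset.sum_mul]
    refine mul_le_of_le_one_left (zero_le) ?_
    rw [← NNReal.coe_le_coe, NNReal.coe_sum]
    have h1 : ‖w‖ ^ 2 ≤ 1 := pow_le_one₀ (norm_nonneg _) hw
    rw [EuclideanSpace.norm_sq_eq] at h1
    simpa using h1

/-- Conditionally on the direction `W`, the inner product with `V` is sub-Gaussian. -/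
theorem measureReal_lt_abs_inner_le [IsProbabilityMeasure P] {n : ℕ}
    {V W : Ω → EuclideanSpace ℝ (Fin n)} {c : NNReal} (hV : Measurable V) (hW : Measurable W)
    (hVW : IndepFun V W P) (hindep : iIndepFun (fun i ω => V ω i) P)
    (hsub : ∀ i, HasSubgaussianMGF (fun ω => V ω i) c P) (hW1 : ∀ ω, ‖W ω‖ ≤ 1)
    {t : ℝ} (ht : 0 ≤ t) :
    P.real {ω | t < |inner ℝ (W ω) (V ω)|} ≤ 2 * Real.exp (-t ^ 2 / (2 * c)) := by
  have := Measure.isProbabilityMeasure_map (μ := P) hV.aemeasurable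
  have := Measure.isProbabilityMeasure_map (μ := P) hW.aemeasurable
  set B : ℝ := 2 * Real.exp (-t ^ 2 / (2 * c))
  have hBnn : 0 ≤ B := by positivity
  have hmeas : MeasurableSet
      {z : EuclideanSpace ℝ (Fin n) × EuclideanSpace ℝ (Fin n) | t < |inner ℝ z.1 z.2|} :=
    measurableSet_lt measurable_const (measurable_fst.inner measurable_snd).abs
  have hae : ∀ᵐ w ∂(P.map W), ‖w‖ ≤ 1 :=
    (ae_map_iff hW.aemeasurable (measurableSet_le measurable_norm measurable_const)).mpr
      (Filter.Eventually.of_forall hW1)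
  have hP : P {ω | t < |inner ℝ (W ω) (V ω)|} ≤ ENNReal.ofReal B := by
    have h1 : P {ω | t < |inner ℝ (W ω) (V ω)|} = P.map (fun ω => (W ω, V ω))
        {z : EuclideanSpace ℝ (Fin n) × EuclideanSpace ℝ (Fin n) | t < |inner ℝ z.1 z.2|} := by
      rw [Measure.map_apply (hW.prodMk hV) hmeas]
      rfl
    rw [h1, hVW.symm.map_prod_eq_prod_map_map hW.aemeasurable hV.aemeasurable,
      Measure.prod_apply hmeas]
    calc ∫⁻ w, P.map V (Prod.mk w ⁻¹' {z | t < |inner ℝ z.1 z.2|}) ∂(P.map W)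
        ≤ ∫⁻ _, ENNReal.ofReal B ∂(P.map W) := by
          refine lintegral_mono_ae ?_
          filter_upwards [hae] with w hw
          rw [Measure.map_apply hV (measurable_prodMk_left hmeas)]
          have h2 := measureReal_lt_abs_le_of_hasSubgaussianMGF
            (hasSubgaussianMGF_inner hindep hsub w hw) ht
          exact (ENNReal.le_ofReal_iff_toReal_le (measure_ne_top _ _) hBnn).mpr h2
      _ = ENNReal.ofReal B := by simp
  exact ENNReal.toReal_le_of_le_ofReal hBnn hP

/-- `E exp (Z² / 4) ≤ √2` for a sub-Gaussian `Z`, by linearization of the square: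
`√π exp (z² / 4) = ∫ exp (-g²) exp (g z) dg`. -/
theorem lintegral_exp_sq_div_four_le [SFinite P] {Z : Ω → ℝ} (hZ : Measurable Z)
    (h : HasSubgaussianMGF Z 1 P) :
    ∫⁻ ω, ENNReal.ofReal (Real.exp (Z ω ^ 2 / 4)) ∂P ≤ ENNReal.ofReal (√2) := by
  have hgauss : ∀ b : ℝ, 0 < b → ∫⁻ g : ℝ, ENNReal.ofReal (Real.exp (-b * g ^ 2)) =
      ENNReal.ofReal (√(Real.pi / b)) := by
    intro b hb
    rw [← integral_gaussian, ofReal_integral_eq_lintegral_ofReal (integrable_exp_neg_mul_sq hb)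
      (Filter.Eventually.of_forall fun _ => (Real.exp_pos _).le)]
  have hlin : ∀ z : ℝ, ∫⁻ g : ℝ, ENNReal.ofReal (Real.exp (-g ^ 2) * Real.exp (g * z)) =
      ENNReal.ofReal (Real.exp (z ^ 2 / 4)) * ENNReal.ofReal (√Real.pi) := by
    intro z
    have h1 : ∀ g : ℝ, ENNReal.ofReal (Real.exp (-g ^ 2) * Real.exp (g * z)) =
        ENNReal.ofReal (Real.exp (z ^ 2 / 4)) *
          ENNReal.ofReal (Real.exp (-1 * (g - z / 2) ^ 2)) := by
      intro g
      rw [← ENNReal.ofReal_mul (Real.exp_pos _).le, ← Real.exp_add, ← Real.exp_add]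
      congr 2
      ring
    simp_rw [h1]
    rw [lintegral_const_mul _ (by fun_prop),
      lintegral_sub_right_eq_self (fun g : ℝ => ENNReal.ofReal (Real.exp (-1 * g ^ 2))),
      hgauss 1 one_pos, div_one]
  have hmgf : ∀ g : ℝ, ∫⁻ ω, ENNReal.ofReal (Real.exp (-g ^ 2) * Real.exp (g * Z ω)) ∂P ≤
      ENNReal.ofReal (Real.exp (-(1 / 2) * g ^ 2)) := by
    intro g
    simp_rw [ENNReal.ofReal_mul (Real.exp_pos (-g ^ 2)).le]
    rw [lintegral_const_mul _ (by fun_prop), ← ofReal_integral_eq_lintegral_ofReal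
      (h.integrable_exp_mul g) (Filter.Eventually.of_forall fun _ => (Real.exp_pos _).le),
      ← ENNReal.ofReal_mul (Real.exp_pos _).le]
    refine ENNReal.ofReal_le_ofReal ?_
    refine (mul_le_mul_of_nonneg_left (h.mgf_le g) (Real.exp_pos _).le).trans_eq ?_
    rw [← Real.exp_add]
    congr 1
    push_cast
    ring
  have hkey : (∫⁻ ω, ENNReal.ofReal (Real.exp (Z ω ^ 2 / 4)) ∂P) * ENNReal.ofReal (√Real.pi) ≤
      ENNReal.ofReal (√2) * ENNReal.ofReal (√Real.pi) := by
    rw [← lintegral_mul_const _ (by fun_prop)]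
    simp_rw [← hlin]
    rw [lintegral_lintegral_swap (by fun_prop)]
    refine (lintegral_mono hmgf).trans_eq ?_
    rw [hgauss _ (by norm_num), ← ENNReal.ofReal_mul (Real.sqrt_nonneg _),
      ← Real.sqrt_mul (by norm_num)]
    congr 2
    ring
  exact (ENNReal.mul_le_mul_iff_left (by simpa using Real.pi_pos) ENNReal.ofReal_ne_top).mp hkey

/-- Tail bound for the squared length of a vector with independent sub-Gaussian entries. -/
theorem measureReal_le_norm_sq_le [IsProbabilityMeasure P] {n : ℕ}
    {V : Ω → EuclideanSpace ℝ (Fin n)} (hV : ∀ i, Measurable fun ω => V ω i)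
    (hindep : iIndepFun (fun i ω => V ω i) P)
    (hsub : ∀ i, HasSubgaussianMGF (fun ω => V ω i) 1 P) (x : ℝ) :
    P.real {ω | x ≤ ‖V ω‖ ^ 2} ≤ Real.exp (-(1 / 4) * x) * √2 ^ n := by
  have hint : ∀ i, Integrable (fun ω => Real.exp (1 / 4 * (V ω i) ^ 2)) P := by
    intro i
    have hm := hV i
    refine ⟨((hm.pow_const 2).const_mul _).exp.aestronglyMeasurable, ?_⟩
    rw [hasFiniteIntegral_iff_ofReal (Filter.Eventually.of_forall fun _ => (Real.exp_pos _).le)]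
    refine lt_of_le_of_lt ?_ (ENNReal.ofReal_lt_top (r := √2))
    simpa only [one_div, inv_mul_eq_div] using lintegral_exp_sq_div_four_le (hV i) (hsub i)
  have hmgf : ∀ i, mgf (fun ω => (V ω i) ^ 2) P (1 / 4) ≤ √2 := by
    intro i
    rw [mgf, integral_eq_lintegral_of_nonneg_ae
      (Filter.Eventually.of_forall fun _ => (Real.exp_pos _).le) (hint i).1]
    refine ENNReal.toReal_le_of_le_ofReal (Real.sqrt_nonneg _) ?_
    simpa only [one_div, inv_mul_eq_div] using lintegral_exp_sq_div_four_le (hV i) (hsub i)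
  have hsq : iIndepFun (fun i ω => (V ω i) ^ 2) P :=
    hindep.comp (fun _ x => x ^ 2) (fun _ => by fun_prop)
  have hsqm : ∀ i, Measurable fun ω => (V ω i) ^ 2 := fun i => (hV i).pow_const 2
  have hnorm : ∀ ω, ‖V ω‖ ^ 2 = (∑ i, fun ω => (V ω i) ^ 2 : Ω → ℝ) ω := by
    intro ω
    rw [EuclideanSpace.norm_sq_eq]
    simp
  simp_rw [hnorm]
  refine (measure_ge_le_exp_mul_mgf x (by norm_num)
    (hsq.integrable_exp_mul_sum hsqm (s := Finset.univ) fun i _ => hint i)).trans ?_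
  rw [hsq.mgf_sum hsqm]
  refine mul_le_mul_of_nonneg_left ?_ (Real.exp_pos _).le
  refine (Finset.prod_le_prod (fun _ _ => mgf_nonneg) fun i _ => hmgf i).trans_eq ?_
  simp

end

/-! ### Exceptional events, constants and recovery -/

noncomputable section

theorem ompThreshold_nonneg (a : ℝ) (p : ℕ) : 0 ≤ ompThreshold a p := Real.sqrt_nonneg _

theorem ompThreshold_sq {a : ℝ} (ha : 0 < a) (p : ℕ) :
    ompThreshold a p ^ 2 = 2 * (1 + a) * Real.log p :=
  Real.sq_sqrt (mul_nonneg (by positivity) (Real.log_natCast_nonneg p))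

theorem exp_neg_ompThreshold_sq {a : ℝ} (ha : 0 < a) {p : ℕ} (hp : 0 < p) :
    Real.exp (-ompThreshold a p ^ 2 / 2) = ((p : ℝ) ^ (1 + a))⁻¹ := by
  have hp' : (0 : ℝ) < p := by exact_mod_cast hp
  rw [ompThreshold_sq ha, ← Real.rpow_neg hp'.le, Real.rpow_def_of_pos hp']
  congr 1
  ring

theorem norm_inv_norm_smul_le {E : Type*} [NormedAddCommGroup E] [NormedSpace ℝ E] (v : E) :
    ‖‖v‖⁻¹ • v‖ ≤ 1 := by
  rw [norm_smul, norm_inv, norm_norm]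
  exact inv_mul_le_one

theorem ompStat_eq_inner_normalized {n p : ℕ} (X : Matrix (Fin n) (Fin p) ℝ)
    (Y : EuclideanSpace ℝ (Fin n)) (d : Finset (Fin p)) (j : Fin p) :
    ompStat X Y d j =
      inner ℝ (‖ompResidual X Y d‖⁻¹ • ompResidual X Y d) (designCol X j) := by
  rw [ompStat, inner_smul_left, real_inner_comm, conj_trivial, div_eq_inv_mul]

theorem iIndepFun_designCol {Ω : Type*} [MeasurableSpace Ω] {P : Measure Ω} {n p : ℕ}
    {X : Ω → Matrix (Fin n) (Fin p) ℝ}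
    (hX_indep : iIndepFun (fun (q : Fin n × Fin p) ω => X ω q.1 q.2) P) (j : Fin p) :
    iIndepFun (fun i ω => designCol (X ω) j i) P :=
  hX_indep.precomp (g := fun i : Fin n => (i, j)) fun _ _ h => (Prod.mk.inj h).1

section Events

variable {Ω : Type*} [MeasurableSpace Ω] {P : Measure Ω} [IsProbabilityMeasure P]
  {n p : ℕ} {X : Ω → Matrix (Fin n) (Fin p) ℝ} {ε : Ω → EuclideanSpace ℝ (Fin n)}

theorem measurable_response {α : Type*} [MeasurableSpace α] {X : α → Matrix (Fin n) (Fin p) ℝ}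
    (hX : ∀ i j, Measurable fun x => X x i j) (β : Fin p → ℝ)
    {ε : α → EuclideanSpace ℝ (Fin n)} (hε : Measurable ε) :
    Measurable fun x => response (X x) β (ε x) :=
  Measurable.add (f := fun x => (WithLp.toLp 2 ((X x).mulVec β) : EuclideanSpace ℝ (Fin n)))
    (measurable_toLp_of_coord fun i => by
      simp only [Matrix.mulVec, dotProduct]
      exact Finset.measurable_fun_sum _ fun j _ => (hX i j).mul_const (β j)) hε

/-- A column outside the set `S` is independent of the columns in `S` together with the noise. -/
theorem indepFun_designCol_restrictCols
    (hX_meas : ∀ i j, Measurable (fun ω => X ω i j)) (hε_meas : Measurable ε)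
    (hX_indep : iIndepFun (fun (q : Fin n × Fin p) ω => X ω q.1 q.2) P)
    (hXε_indep : IndepFun (fun ω (q : Fin n × Fin p) => X ω q.1 q.2) ε P)
    {S : Finset (Fin p)} {j : Fin p} (hj : j ∉ S) :
    IndepFun (fun ω => designCol (X ω) j)
      (fun ω => ((fun q : Fin n × Fin p => restrictCols S (X ω) q.1 q.2), ε ω)) P := by
  set V : (Fin n × Fin p → ℝ) → EuclideanSpace ℝ (Fin n) :=
    fun x => WithLp.toLp 2 fun i => x (i, j)
  set A : (Fin n × Fin p → ℝ) → (Fin n × Fin p → ℝ) :=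
    fun x q => if q.2 ∈ S then x q else 0 with hA
  have hVm : Measurable V := measurable_toLp_of_coord fun i => measurable_pi_apply _
  have hAm : Measurable A := by
    refine measurable_pi_lambda _ fun q => ?_
    by_cases hq : q.2 ∈ S
    · simpa [hA, hq] using measurable_pi_apply q
    · simp [hA, hq]
  have hXm : Measurable fun ω (q : Fin n × Fin p) => X ω q.1 q.2 :=
    measurable_pi_lambda _ fun q => hX_meas q.1 q.2
  refine IndepFun.prodMk_right_of_prodMk_left (hVm.comp hXm) (hAm.comp hXm) hε_meas ?_
    (hXε_indep.comp (hVm.prodMk hAm) measurable_id)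
  let T₁ : Finset (Fin n × Fin p) := Finset.univ.filter fun q => q.2 = j
  let T₂ : Finset (Fin n × Fin p) := Finset.univ.filter fun q => q.2 ∈ S
  have hdisj : Disjoint T₁ T₂ := by
    refine Finset.disjoint_filter.mpr ?_
    rintro q - rfl
    exact hj
  have h := hX_indep.indepFun_finset T₁ T₂ hdisj fun q => hX_meas q.1 q.2
  let ψ₁ : (T₁ → ℝ) → EuclideanSpace ℝ (Fin n) :=
    fun z => WithLp.toLp 2 fun i => z ⟨(i, j), by simp [T₁]⟩
  let ψ₂ : (T₂ → ℝ) → (Fin n × Fin p → ℝ) :=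
    fun z q => if hq : q.2 ∈ S then z ⟨q, by simpa [T₂] using hq⟩ else 0
  have hψ₁ : Measurable ψ₁ := measurable_toLp_of_coord fun i => measurable_pi_apply _
  have hψ₂ : Measurable ψ₂ := by
    refine measurable_pi_lambda _ fun q => ?_
    by_cases hq : q.2 ∈ S
    · simpa [ψ₂, hq] using measurable_pi_apply _
    · simp [ψ₂, hq]
  exact h.comp hψ₁ hψ₂

/-- Along the path on the columns in the true support, a statistic of a null column exceeds the
threshold with probability at most `2 / p ^ (1 + a)`. -/
theorem measureReal_threshold_lt_abs_ompStat_le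
    (hX_meas : ∀ i j, Measurable (fun ω => X ω i j)) (hε_meas : Measurable ε)
    (hX_indep : iIndepFun (fun (q : Fin n × Fin p) ω => X ω q.1 q.2) P)
    (hXε_indep : IndepFun (fun ω (q : Fin n × Fin p) => X ω q.1 q.2) ε P)
    (hX_subG : ∀ i j, HasSubgaussianMGF (fun ω => X ω i j) 1 P)
    {sel : Finset (Fin p) → Fin p} (hsel : ∀ s : Finset (Fin p), s.Nonempty → sel s ∈ s)
    (β : Fin p → ℝ) {a : ℝ} (ha : 0 < a) (m : ℕ) {j : Fin p} (hj : j ∉ trueSupport β) :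
    P.real {ω | ompThreshold a p < |ompStat (X ω) (response (X ω) β (ε ω))
      (ompPath sel (restrictCols (trueSupport β) (X ω)) (response (X ω) β (ε ω))
        (ompThreshold a p) m) j|} ≤ 2 * ((p : ℝ) ^ (1 + a))⁻¹ := by
  set S := trueSupport β
  set τ := ompThreshold a p
  let M : (Fin n × Fin p → ℝ) × EuclideanSpace ℝ (Fin n) → Matrix (Fin n) (Fin p) ℝ :=
    fun z i l => z.1 (i, l)
  have hM : ∀ i l, Measurable fun z => M z i l :=
    fun i l => (measurable_pi_apply (i, l)).comp measurable_fst
  have hresp : Measurable fun z => response (M z) β z.2 := measurable_response hM β measurable_snd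
  have hR := measurable_ompResidual_ompPath sel hM hresp τ m
  have hW := hR.norm.inv.smul hR
  have hA : Measurable fun ω => (fun q : Fin n × Fin p => restrictCols S (X ω) q.1 q.2) := by
    refine measurable_pi_lambda _ fun q => ?_
    by_cases hq : q.2 ∈ S
    · simpa [restrictCols, hq] using hX_meas q.1 q.2
    · simp [restrictCols, hq]
  have hind := (indepFun_designCol_restrictCols hX_meas hε_meas hX_indep hXε_indep hj).comp
    measurable_id hW
  have h := measureReal_lt_abs_inner_le (measurable_designCol hX_meas j)
    (hW.comp (hA.prodMk hε_meas)) hind (iIndepFun_designCol hX_indep j) (fun i => hX_subG i j)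
    (fun ω => norm_inv_norm_smul_le _) (ompThreshold_nonneg a p)
  have hp : 0 < p := j.pos
  rw [NNReal.coe_one, mul_one, exp_neg_ompThreshold_sq ha hp] at h
  refine (measureReal_mono fun ω hω => ?_).trans h
  have hω' : τ < |ompStat (X ω) (response (X ω) β (ε ω))
      (ompPath sel (restrictCols S (X ω)) (response (X ω) β (ε ω)) τ m) j| := hω
  rw [ompStat_eq_inner_normalized, ← ompResidual_restrictCols
    (ompPath_restrictCols_subset hsel S (X ω) _ (ompThreshold_nonneg a p) m),
    ← response_restrictCols] at hω'
  exact hω'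

/-- Union bound over the residuals of the path and the null columns. -/
theorem measureReal_exists_threshold_lt_abs_ompStat_le
    (hX_meas : ∀ i j, Measurable (fun ω => X ω i j)) (hε_meas : Measurable ε)
    (hX_indep : iIndepFun (fun (q : Fin n × Fin p) ω => X ω q.1 q.2) P)
    (hXε_indep : IndepFun (fun ω (q : Fin n × Fin p) => X ω q.1 q.2) ε P)
    (hX_subG : ∀ i j, HasSubgaussianMGF (fun ω => X ω i j) 1 P)
    {sel : Finset (Fin p) → Fin p} (hsel : ∀ s : Finset (Fin p), s.Nonempty → sel s ∈ s)
    (β : Fin p → ℝ) {a : ℝ} (ha : 0 < a) :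
    P.real {ω | ∃ m ≤ (trueSupport β).card, ∃ j ∉ trueSupport β, ompThreshold a p <
      |ompStat (X ω) (response (X ω) β (ε ω))
        (ompPath sel (restrictCols (trueSupport β) (X ω)) (response (X ω) β (ε ω))
          (ompThreshold a p) m) j|} ≤ 2 * ((trueSupport β).card + 1) / (p : ℝ) ^ a := by
  set S := trueSupport β
  set F : ℕ → Fin p → Set Ω := fun m j => {ω | ompThreshold a p <
      |ompStat (X ω) (response (X ω) β (ε ω))
        (ompPath sel (restrictCols S (X ω)) (response (X ω) β (ε ω))
          (ompThreshold a p) m) j|}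
  have hsub : {ω | ∃ m ≤ S.card, ∃ j ∉ S, ompThreshold a p <
      |ompStat (X ω) (response (X ω) β (ε ω))
        (ompPath sel (restrictCols S (X ω)) (response (X ω) β (ε ω))
          (ompThreshold a p) m) j|} ⊆ ⋃ m ∈ Finset.range (S.card + 1), ⋃ j ∈ Sᶜ, F m j := by
    rintro ω ⟨m, hm, j, hj, hlt⟩
    simp only [Set.mem_iUnion]
    exact ⟨m, Finset.mem_range.mpr (by omega), j, by simpa using hj, hlt⟩
  refine (measureReal_mono hsub (measure_ne_top _ _)).trans
    ((measureReal_biUnion_finset_le _ _).trans ?_)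
  have hone : ∀ m, P.real (⋃ j ∈ Sᶜ, F m j) ≤ 2 / (p : ℝ) ^ a := by
    intro m
    refine (measureReal_biUnion_finset_le _ _).trans ?_
    refine (Finset.sum_le_card_nsmul _ _ (2 * ((p : ℝ) ^ (1 + a))⁻¹) fun j hj =>
      measureReal_threshold_lt_abs_ompStat_le hX_meas hε_meas hX_indep hXε_indep hX_subG hsel β ha
        m (by simpa using hj)).trans ?_
    rw [nsmul_eq_mul]
    have hcard : ((Sᶜ).card : ℝ) ≤ p := by
      exact_mod_cast (Finset.card_le_univ _).trans_eq (Fintype.card_fin p)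
    refine (mul_le_mul_of_nonneg_right hcard (by positivity)).trans ?_
    rcases Nat.eq_zero_or_pos p with rfl | hp
    · simp only [Nat.cast_zero, zero_mul]; positivity
    · have hp' : (0 : ℝ) < p := by exact_mod_cast hp
      rw [Real.rpow_add hp', Real.rpow_one]
      exact le_of_eq (by field_simp)
  refine (Finset.sum_le_card_nsmul _ _ _ fun m _ => hone m).trans_eq ?_
  rw [Finset.card_range, nsmul_eq_mul]
  push_cast
  ring

/-- Union bound for the least-squares coefficients of the noise on the columns in `S`. -/
theorem measureReal_exists_threshold_lt_abs_inner_noise_le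
    (hX_meas : ∀ i j, Measurable (fun ω => X ω i j)) (hε_meas : Measurable ε)
    (hε_indep : iIndepFun (fun (i : Fin n) ω => ε ω i) P)
    (hXε_indep : IndepFun (fun ω (q : Fin n × Fin p) => X ω q.1 q.2) ε P)
    {σ : ℝ} (hσ : 0 < σ) (hε_subG : ∀ i, HasSubgaussianMGF (fun ω => ε ω i)
      ⟨σ ^ 2, sq_nonneg σ⟩ P) (S : Finset (Fin p)) {a : ℝ} (ha : 0 < a) :
    P.real {ω | ∃ j ∈ S, σ * ompThreshold a p <
      |inner ℝ ((‖ompResidual (X ω) (designCol (X ω) j) (S.erase j)‖)⁻¹ •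
        ompResidual (X ω) (designCol (X ω) j) (S.erase j)) (ε ω)|} ≤
      2 * S.card / (p : ℝ) ^ (1 + a) := by
  set F : Fin p → Set Ω := fun j => {ω | σ * ompThreshold a p <
      |inner ℝ ((‖ompResidual (X ω) (designCol (X ω) j) (S.erase j)‖)⁻¹ •
        ompResidual (X ω) (designCol (X ω) j) (S.erase j)) (ε ω)|}
  have hsub : {ω | ∃ j ∈ S, ω ∈ F j} ⊆ ⋃ j ∈ S, F j := by
    rintro ω ⟨j, hj, hlt⟩
    simp only [Set.mem_iUnion]
    exact ⟨j, hj, hlt⟩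
  have hone : ∀ j, P.real (F j) ≤ 2 * ((p : ℝ) ^ (1 + a))⁻¹ := by
    intro j
    let M : (Fin n × Fin p → ℝ) → Matrix (Fin n) (Fin p) ℝ := fun z i l => z (i, l)
    have hM : ∀ i l, Measurable fun z => M z i l := fun i l => measurable_pi_apply (i, l)
    have hR := measurable_ompResidual hM (S.erase j) (measurable_designCol hM j)
    have hW := hR.norm.inv.smul hR
    have hXm : Measurable fun ω (q : Fin n × Fin p) => X ω q.1 q.2 :=
      measurable_pi_lambda _ fun q => hX_meas q.1 q.2
    have h := measureReal_lt_abs_inner_le hε_meas (hW.comp hXm)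
      (hXε_indep.comp hW measurable_id).symm hε_indep hε_subG
      (fun ω => norm_inv_norm_smul_le _) (mul_nonneg hσ.le (ompThreshold_nonneg a p))
    refine h.trans_eq ?_
    rw [← exp_neg_ompThreshold_sq ha j.pos]
    congr 2
    change -(σ * ompThreshold a p) ^ 2 / (2 * σ ^ 2) = _
    field_simp
  refine (measureReal_mono hsub (measure_ne_top _ _)).trans
    ((measureReal_biUnion_finset_le _ _).trans ?_)
  refine (Finset.sum_le_card_nsmul _ _ _ fun j _ => hone j).trans_eq ?_
  rw [nsmul_eq_mul]
  ring

end Events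

section Constants

variable {n p k : ℕ} {lmin lmax lam a σ : ℝ}

theorem one_le_ratioTwo_sq_mul (hl : 0 < lmin) : 1 ≤ ratioTwo lmin lmax lam ^ 2 * lmin := by
  have h1 : 1 / √lmin ≤ ratioTwo lmin lmax lam := le_add_of_nonneg_right (Real.sqrt_nonneg _)
  have h2 : (1 / √lmin) ^ 2 ≤ ratioTwo lmin lmax lam ^ 2 :=
    pow_le_pow_left₀ (by positivity) h1 2
  rw [div_pow, one_pow, Real.sq_sqrt hl.le, div_le_iff₀ hl] at h2
  exact h2

/-- The sample size makes `√k τ / √(n λ_min)` at most `1/4`; the factor `r₂²` in it is used only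
through `r₂ ≥ 1 / √λ_min`. -/
theorem sixteen_mul_threshold_sq_le (hl : 0 < lmin) (ha : 0 < a)
    (hn : 32 * ratioTwo lmin lmax lam ^ 2 * (1 + a) * k * Real.log p ≤ n) :
    16 * ((k : ℝ) * ompThreshold a p ^ 2) ≤ n * lmin := by
  rw [ompThreshold_sq ha]
  have hlog := Real.log_natCast_nonneg p
  have h1 := mul_le_mul_of_nonneg_right hn hl.le
  have h2 := mul_le_mul_of_nonneg_left (one_le_ratioTwo_sq_mul (lmax := lmax) (lam := lam) hl)
    (show 0 ≤ 32 * (1 + a) * k * Real.log p by positivity)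
  nlinarith

/-- The signal strength `r σ μ_n` covers both the misfit and the noise part of a missed
coefficient. The misfit part is where an upper bound on `λ_min` is needed, since `r₁` has
`λ_min³` in place of `λ_min²`. -/
theorem missed_coeff_bound_le (hl : 0 < lmin) (hl' : lmin ≤ 9 / 4) (hlam : 0 < lam) (ha : 0 < a)
    (hσ : 0 < σ) (hn : 0 < n) :
    4 / 3 * (ompThreshold a p * σ * √lam / (lmin * √n)) + σ * ompThreshold a p / √(n * lmin) ≤
      2 * ratioTwo lmin lmax lam * √(1 + a) * σ * noiseLevel n p := by
  have hn' : (0 : ℝ) < n := by exact_mod_cast hn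
  have hsn : 0 < √(n : ℝ) := Real.sqrt_pos.mpr hn'
  have hsl : 0 < √lmin := Real.sqrt_pos.mpr hl
  have hlog := Real.log_natCast_nonneg p
  have hτ : √(1 + a) * noiseLevel n p = ompThreshold a p / √n := by
    rw [noiseLevel, ompThreshold, ← Real.sqrt_mul (by positivity), ← Real.sqrt_div (by positivity)]
    congr 1
    ring
  have hkey : 4 / 3 * (√lam / lmin) ≤ 2 * √(ratioOne lmin lmax lam) := by
    apply le_of_sq_le_sq _ (by positivity)
    have hr : 0 ≤ ratioOne lmin lmax lam :=
      div_nonneg (hlam.le.trans (le_max_right _ _)) (by positivity)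
    rw [mul_pow, mul_pow, div_pow (√lam), Real.sq_sqrt hlam.le, Real.sq_sqrt hr, ratioOne]
    have h1 : lam / lmin ^ 3 ≤ max lmax lam / lmin ^ 3 :=
      div_le_div_of_nonneg_right (le_max_right _ _) (by positivity)
    have h2 : (4 / 3) ^ 2 * (lam / lmin ^ 2) ≤ 2 ^ 2 * (lam / lmin ^ 3) := by
      rw [← sub_nonneg]
      have : 2 ^ 2 * (lam / lmin ^ 3) - (4 / 3) ^ 2 * (lam / lmin ^ 2) =
          16 / 9 * (lam / lmin ^ 3) * (9 / 4 - lmin) := by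
        field_simp
        ring
      rw [this]
      exact mul_nonneg (by positivity) (by linarith)
    linarith
  have hsum : 4 / 3 * (√lam / lmin) + 1 / √lmin ≤ 2 * ratioTwo lmin lmax lam := by
    have : 0 ≤ 1 / √lmin := by positivity
    rw [ratioTwo]
    linarith
  calc _ = (4 / 3 * (√lam / lmin) + 1 / √lmin) * (σ * (ompThreshold a p / √n)) := by
        rw [Real.sqrt_mul hn'.le]
        field_simp
    _ ≤ 2 * ratioTwo lmin lmax lam * (σ * (ompThreshold a p / √n)) :=
        mul_le_mul_of_nonneg_right hsum
          (mul_nonneg hσ.le (div_nonneg (ompThreshold_nonneg a p) hsn.le))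
    _ = _ := by rw [← hτ]; ring

end Constants

section Conclusion

variable {n p : ℕ} {X : Matrix (Fin n) (Fin p) ℝ} {β : Fin p → ℝ}
  {ε : EuclideanSpace ℝ (Fin n)} {lmin lmax lam σ a s : ℝ}

/-- The deterministic part of the recovery: if the coefficients of the missed columns, perturbed
by `ξ`, are at most `B` in root mean square, and `ξ` is at most `b`, then every coefficient larger
than `√k (B + b)` is detected, and all are if each one exceeds `B + b`. -/
theorem recovery_of_sum_sq_le {S d : Finset (Fin p)} (hS : S = trueSupport β) (hd : d ⊆ S)
    {ξ : Fin p → ℝ} {B b : ℝ} (hB : 0 ≤ B) (hb : 0 ≤ b) (hξ : ∀ j ∈ S, |ξ j| ≤ b)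
    (hsum : ∑ j ∈ S \ d, (β j + ξ j) ^ 2 ≤ ((S \ d).card : ℝ) * B ^ 2) (hBs : B + b ≤ s) :
    (∀ j, s * √S.card < |β j| → j ∈ d) ∧ ((∀ j ∈ S, s < |β j|) → d = S) := by
  constructor
  · intro j hj
    by_contra hjd
    have hs : 0 ≤ s := by linarith
    have hβ : β j ≠ 0 := abs_pos.mp (lt_of_le_of_lt (by positivity) hj)
    have hjS : j ∈ S := by rw [hS]; simpa [trueSupport] using hβ
    have h1 : (β j + ξ j) ^ 2 ≤ (√S.card * B) ^ 2 := by
      have h2 := Finset.single_le_sum (f := fun i => (β i + ξ i) ^ 2)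
        (fun i _ => sq_nonneg _) (Finset.mem_sdiff.mpr ⟨hjS, hjd⟩)
      have h3 : ((S \ d).card : ℝ) ≤ S.card := by
        exact_mod_cast Finset.card_le_card Finset.sdiff_subset
      rw [mul_pow, Real.sq_sqrt (Nat.cast_nonneg _)]
      exact h2.trans (hsum.trans (mul_le_mul_of_nonneg_right h3 (sq_nonneg B)))
    have h4 : |β j + ξ j| ≤ √S.card * B := abs_le_of_sq_le_sq h1 (by positivity)
    have h5 : |β j| ≤ |β j + ξ j| + |ξ j| := by
      have := abs_sub (β j + ξ j) (ξ j)
      rwa [add_sub_cancel_right] at this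
    have h6 : 1 ≤ √(S.card : ℝ) := by
      rw [Real.one_le_sqrt]
      exact_mod_cast Finset.card_pos.mpr ⟨j, hjS⟩
    have h7 := hξ j hjS
    nlinarith
  · intro hall
    by_contra hne
    have hne' : (S \ d).Nonempty := by
      rw [Finset.sdiff_nonempty]
      exact fun h => hne (Finset.Subset.antisymm hd h)
    have hlt : ∑ _j ∈ S \ d, B ^ 2 < ∑ j ∈ S \ d, (β j + ξ j) ^ 2 := by
      refine Finset.sum_lt_sum_of_nonempty hne' fun j hj => ?_
      have hjS := (Finset.mem_sdiff.mp hj).1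
      have h5 : |β j| ≤ |β j + ξ j| + |ξ j| := by
        have := abs_sub (β j + ξ j) (ξ j)
        rwa [add_sub_cancel_right] at this
      have h7 := hξ j hjS
      have h8 := hall j hjS
      rw [← sq_abs (β j + ξ j)]
      exact pow_lt_pow_left₀ (by linarith) hB two_ne_zero
    rw [Finset.sum_const, nsmul_eq_mul] at hlt
    linarith

/-- The whole deterministic part: outside the exceptional events the algorithm detects only true
indices and misses only small coefficients. -/
theorem ompSupport_recovery {sel : Finset (Fin p) → Fin p}
    (hsel : ∀ s : Finset (Fin p), s.Nonempty → sel s ∈ s) (hE : EigenCondition X (trueSupport β)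
      lmin lmax) (hN : NoiseCondition ε σ lam) (hl : 0 < lmin) (hl' : lmin ≤ 9 / 4)
    (hlam : 0 < lam) (ha : 0 < a) (hσ : 0 < σ) (hn : 0 < n)
    (hbig : 16 * (((trueSupport β).card : ℝ) * ompThreshold a p ^ 2) ≤ n * lmin)
    (hnull : ompSupport sel X (response X β ε) (ompThreshold a p) ⊆ trueSupport β)
    (hnoise : ∀ j ∈ trueSupport β,
      |inner ℝ ((‖ompResidual X (designCol X j) ((trueSupport β).erase j)‖)⁻¹ •
        ompResidual X (designCol X j) ((trueSupport β).erase j)) ε| ≤ σ * ompThreshold a p) :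
    (∀ j, 2 * ratioTwo lmin lmax lam * √(1 + a) * σ * noiseLevel n p * √(trueSupport β).card <
        |β j| → j ∈ ompSupport sel X (response X β ε) (ompThreshold a p)) ∧
      ((∀ j ∈ trueSupport β,
        2 * ratioTwo lmin lmax lam * √(1 + a) * σ * noiseLevel n p < |β j|) →
        ompSupport sel X (response X β ε) (ompThreshold a p) = trueSupport β) := by
  have hτ := ompThreshold_nonneg a p
  obtain ⟨ξ, hξ⟩ := exists_sum_eq_of_mem_span_designCol X (trueSupport β)
    (Submodule.starProjection_apply_mem
      (Submodule.span ℝ (designCol X '' (trueSupport β : Set (Fin p)))) ε)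
  exact recovery_of_sum_sq_le rfl hnull (by positivity) (by positivity)
    (fun j hj => abs_coeff_le_of_abs_inner_le hE hl hn hξ hj (hnoise j hj))
    (sum_sq_le_of_stopped hE hl hn hσ hlam hτ hN hξ hnull hbig fun j hj =>
      ompSupport_stopped sel hsel X _ _ j (Finset.mem_sdiff.mp hj).2)
    (missed_coeff_bound_le hl hl' hlam ha hσ hn)

/-- For `λ_min > 9/4` the eigenvalue condition fails except on an event whose probability is
covered by the other terms of the error bound: a column would have to be too long. -/
theorem measureReal_eigenCondition_le {Ω : Type*} [MeasurableSpace Ω] {P : Measure Ω}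
    [IsProbabilityMeasure P] {X : Ω → Matrix (Fin n) (Fin p) ℝ}
    (hX_meas : ∀ i j, Measurable (fun ω => X ω i j))
    (hX_indep : iIndepFun (fun (q : Fin n × Fin p) ω => X ω q.1 q.2) P)
    (hX_subG : ∀ i j, HasSubgaussianMGF (fun ω => X ω i j) 1 P) {S : Finset (Fin p)}
    (hS : S.Nonempty) (hn : 0 < n) (ha : 0 < a) (hl : 9 / 4 < lmin)
    (hbig : 16 * ompThreshold a p ^ 2 ≤ n * lmin) :
    P.real {ω | EigenCondition (X ω) S lmin lmax} ≤ 1 / (p : ℝ) ^ a := by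
  obtain ⟨j, hj⟩ := hS
  have hsub : {ω | EigenCondition (X ω) S lmin lmax} ⊆
      {ω | n * lmin ≤ ‖designCol (X ω) j‖ ^ 2} := by
    intro ω hω
    have h1 := EigenCondition.le_norm_sq_sum hω hn (Pi.single j 1)
    have h2 : ∑ i ∈ S, (Pi.single j 1 : Fin p → ℝ) i • designCol (X ω) i = designCol (X ω) j := by
      rw [Finset.sum_eq_single_of_mem j hj fun i _ hi => by rw [Pi.single_eq_of_ne hi, zero_smul]]
      simp
    have h3 : ∑ i ∈ S, (Pi.single j 1 : Fin p → ℝ) i ^ 2 = 1 := by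
      rw [Finset.sum_eq_single_of_mem j hj fun i _ hi => by simp [Pi.single_eq_of_ne hi]]
      simp
    rw [h2, h3, mul_one] at h1
    exact h1
  have htail := measureReal_le_norm_sq_le (V := fun ω => designCol (X ω) j)
    (fun i => hX_meas i j) (iIndepFun_designCol hX_indep j) (fun i => hX_subG i j) (n * lmin)
  refine (measureReal_mono hsub).trans (htail.trans ?_)
  have hp' : (0 : ℝ) < p := by exact_mod_cast j.pos
  have hsqrt2 : √2 = Real.exp (Real.log 2 / 2) := by
    rw [← Real.log_sqrt (by norm_num), Real.exp_log (by positivity)]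
  rw [hsqrt2, ← Real.exp_nat_mul, ← Real.exp_add, one_div ((p : ℝ) ^ a),
    ← Real.rpow_neg hp'.le, Real.rpow_def_of_pos hp']
  refine Real.exp_le_exp.mpr ?_
  rw [ompThreshold_sq ha] at hbig
  have hlog := Real.log_natCast_nonneg p
  have hlog2 := Real.log_two_lt_d9
  have hn' : (0 : ℝ) < n := by exact_mod_cast hn
  -- the exponent is at most `-n λ_min / 32`: here `λ_min > 9/4` gives `log 2 / 2 ≤ 7 λ_min / 32`
  have h1 : (n : ℝ) * (Real.log 2 / 2) ≤ n * (7 / 32 * lmin) :=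
    mul_le_mul_of_nonneg_left (by linarith) hn'.le
  nlinarith

end Conclusion

end

theorem mainTheorem5 {Ω : Type*} [MeasurableSpace Ω] (P : Measure Ω) [IsProbabilityMeasure P]
    (n p k kbar : ℕ)
    -- the tie-breaking rule of the algorithm
    (sel : Finset (Fin p) → Fin p) (hsel : ∀ s : Finset (Fin p), s.Nonempty → sel s ∈ s)
    -- the coefficient vector
    (β : Fin p → ℝ) (hk : (trueSupport β).card = k) (hkbar : k ≤ kbar) (hkbar_pos : 1 ≤ kbar)
    -- the random design and the noise
    (X : Ω → Matrix (Fin n) (Fin p) ℝ) (ε : Ω → EuclideanSpace ℝ (Fin n)) (σ : ℝ) (hσ : 0 < σ)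
    (hX_meas : ∀ i j, Measurable (fun ω => X ω i j))
    (hε_meas : ∀ i, Measurable (fun ω => ε ω i))
    (hX_indep : iIndepFun (fun (q : Fin n × Fin p) ω => X ω q.1 q.2) P)
    (hε_indep : iIndepFun (fun (i : Fin n) ω => ε ω i) P)
    (hXε_indep : IndepFun (fun ω (q : Fin n × Fin p) => X ω q.1 q.2) ε P)
    (hX_subG : ∀ i j, HasSubgaussianMGF (fun ω => X ω i j) 1 P)
    (hε_subG : ∀ i, HasSubgaussianMGF (fun ω => ε ω i) ⟨σ ^ 2, sq_nonneg σ⟩ P)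
    -- the constants
    (lmin lmax lam a : ℝ) (hlmin : 0 < lmin) (hlmax : lmin ≤ lmax) (hlam : 0 < lam) (ha : 0 < a)
    (r : ℝ) (hr : r = 2 * ratioTwo lmin lmax lam * √(1 + a))
    -- the sample size
    (hn : 32 * ratioTwo lmin lmax lam ^ 2 * (1 + a) * kbar * Real.log p ≤ n)
    -- the estimate of the support and the bound on the probability of failure
    (Shat : Ω → Finset (Fin p))
    (hShat : ∀ ω, Shat ω = ompSupport sel (X ω) (response (X ω) β (ε ω)) (ompThreshold a p))
    (perr : ℝ)
    (hperr : perr = errProb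
      (P.real {ω | ¬ (EigenCondition (X ω) (trueSupport β) lmin lmax ∧
        NoiseCondition (ε ω) σ lam)}) a p k) :
    (1 ≤ k →
      1 - perr ≤ P.real {ω | Shat ω ⊆ trueSupport β ∧
        ∀ j, r * σ * √k * noiseLevel n p < |β j| → j ∈ Shat ω} ∧
      ∀ βmin : ℝ, 0 < βmin → (∀ j ∈ trueSupport β, βmin ≤ |β j|) →
        r * σ * noiseLevel n p < βmin →
        1 - perr ≤ P.real {ω | Shat ω = trueSupport β}) ∧
    (k = 0 → 1 - perr ≤ P.real {ω | Shat ω = ∅}) := by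
  subst hk hr
  obtain rfl : Shat = _ := funext hShat
  have hε : Measurable ε := measurable_toLp_of_coord hε_meas
  have hτ := ompThreshold_nonneg a p
  set S := trueSupport β
  set bad : Set Ω := {ω | ¬ (EigenCondition (X ω) S lmin lmax ∧ NoiseCondition (ε ω) σ lam)}
  set A : Set Ω := {ω | ∃ m ≤ S.card, ∃ j ∉ S, ompThreshold a p <
      |ompStat (X ω) (response (X ω) β (ε ω))
        (ompPath sel (restrictCols S (X ω)) (response (X ω) β (ε ω))
          (ompThreshold a p) m) j|}
  set N : Set Ω := {ω | ∃ j ∈ S, σ * ompThreshold a p <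
      |inner ℝ ((‖ompResidual (X ω) (designCol (X ω) j) (S.erase j)‖)⁻¹ •
        ompResidual (X ω) (designCol (X ω) j) (S.erase j)) (ε ω)|}
  have hPA : P.real A ≤ 2 * (S.card + 1) / (p : ℝ) ^ a :=
    measureReal_exists_threshold_lt_abs_ompStat_le hX_meas hε hX_indep hXε_indep hX_subG hsel β ha
  have hPN : P.real N ≤ 2 * S.card / (p : ℝ) ^ (1 + a) :=
    measureReal_exists_threshold_lt_abs_inner_noise_le hX_meas hε hε_indep hXε_indep hσ hε_subG S ha
  have hsubset : ∀ ω ∉ A,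
      ompSupport sel (X ω) (response (X ω) β (ε ω)) (ompThreshold a p) ⊆ S := by
    intro ω hω
    refine ompSupport_subset_of_restrictCols hsel S (X ω) _ hτ fun m hm j hj => ?_
    by_contra hlt
    exact hω ⟨m, hm, j, hj, not_le.mp hlt⟩
  have hone : P.real (Set.univ : Set Ω) = 1 := by simp
  refine ⟨fun hk1 => ?_, fun hk0 => ?_⟩
  · have hSne : S.Nonempty := Finset.card_pos.mp hk1
    rw [errProb, if_neg (by omega)] at hperr
    -- it suffices to describe the outcome outside the exceptional events, when the bound is
    -- not void
    have hred : ∀ G : Set Ω, (0 < n → lmin ≤ 9 / 4 → ∀ ω, ω ∉ bad → ω ∉ A → ω ∉ N → ω ∈ G) →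
        1 - perr ≤ P.real G := by
      intro G hG
      have hp : 0 < p := hSne.choose.pos
      have hp' : (0 : ℝ) < p := by exact_mod_cast hp
      have hpa : 0 < (p : ℝ) ^ a := Real.rpow_pos_of_pos hp' a
      have hN0 : 0 ≤ 2 * (S.card : ℝ) / (p : ℝ) ^ (1 + a) := by positivity
      have hb0 : 0 ≤ P.real bad := measureReal_nonneg
      have hG0 : 0 ≤ P.real G := measureReal_nonneg
      have hA1 : 1 / (p : ℝ) ^ a ≤ 2 * (S.card + 1) / (p : ℝ) ^ a := by
        refine div_le_div_of_nonneg_right ?_ hpa.le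
        have : (0 : ℝ) ≤ S.card := Nat.cast_nonneg _
        linarith
      have hkbar' : (S.card : ℝ) ≤ kbar := by exact_mod_cast hkbar
      have hbig : 16 * ((kbar : ℝ) * ompThreshold a p ^ 2) ≤ n * lmin :=
        sixteen_mul_threshold_sq_le hlmin ha hn
      have hbigS : 16 * ((S.card : ℝ) * ompThreshold a p ^ 2) ≤ n * lmin := by
        have := mul_le_mul_of_nonneg_right hkbar' (sq_nonneg (ompThreshold a p))
        linarith
      rcases Nat.eq_or_lt_of_le (Nat.succ_le_of_lt hp) with hp1 | hp2
      · -- for `p = 1` the error bound exceeds `1`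
        have : (p : ℝ) ^ a = 1 := by rw [← hp1]; simp
        rw [this] at hA1 hperr
        linarith
      have hn0 : 0 < n := by
        rcases Nat.eq_zero_or_pos n with rfl | h
        · have h1 : 0 < ompThreshold a p ^ 2 := by
            rw [ompThreshold_sq ha]
            have := Real.log_pos (show (1 : ℝ) < p by exact_mod_cast hp2)
            positivity
          have h2 : (1 : ℝ) ≤ S.card := by exact_mod_cast hk1
          rw [Nat.cast_zero, zero_mul] at hbigS
          nlinarith
        · exact h
      -- for `λ_min > 9/4` the eigenvalue condition fails so often that the bound is void
      rcases le_or_gt lmin (9 / 4) with hl | hl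
      · have hcover : (Set.univ : Set Ω) ⊆ G ∪ (bad ∪ (A ∪ N)) := by
          intro ω _
          by_contra hω
          simp only [Set.mem_union, not_or] at hω
          exact hω.1 (hG hn0 hl ω hω.2.1 hω.2.2.1 hω.2.2.2)
        have h1 := measureReal_mono (μ := P) hcover (measure_ne_top _ _)
        have h2 := measureReal_union_le (μ := P) G (bad ∪ (A ∪ N))
        have h3 := measureReal_union_le (μ := P) bad (A ∪ N)
        have h4 := measureReal_union_le (μ := P) A N
        linarith
      · have hE := measureReal_eigenCondition_le (lmax := lmax) hX_meas hX_indep hX_subG hSne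
          hn0 ha hl (by
            have h2 : (1 : ℝ) ≤ S.card := by exact_mod_cast hk1
            have := mul_le_mul_of_nonneg_right h2 (sq_nonneg (ompThreshold a p))
            linarith)
        have hcover : (Set.univ : Set Ω) ⊆ {ω | EigenCondition (X ω) S lmin lmax} ∪ bad := by
          intro ω _
          by_cases h : EigenCondition (X ω) S lmin lmax
          · exact Or.inl h
          · exact Or.inr fun h' => h h'.1
        have h1 := measureReal_mono (μ := P) hcover (measure_ne_top _ _)
        have h2 := measureReal_union_le (μ := P) {ω | EigenCondition (X ω) S lmin lmax} bad
        linarith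
    have hrec : 0 < n → lmin ≤ 9 / 4 → ∀ ω, ω ∉ bad → ω ∉ A → ω ∉ N → _ :=
      fun hn0 hl ω hb hAω hNω => ompSupport_recovery hsel (not_not.mp hb).1 (not_not.mp hb).2
        hlmin hl hlam ha hσ hn0
        (by
          have h1 : 16 * ((kbar : ℝ) * ompThreshold a p ^ 2) ≤ n * lmin :=
            sixteen_mul_threshold_sq_le hlmin ha hn
          have h2 : (S.card : ℝ) ≤ kbar := by exact_mod_cast hkbar
          have := mul_le_mul_of_nonneg_right h2 (sq_nonneg (ompThreshold a p))
          linarith)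
        (hsubset ω hAω) (fun j hj => by
          by_contra hlt
          exact hNω ⟨j, hj, not_le.mp hlt⟩)
    refine ⟨hred _ fun hn0 hl ω hb hAω hNω => ⟨hsubset ω hAω, fun j hj => ?_⟩, ?_⟩
    · refine (hrec hn0 hl ω hb hAω hNω).1 j (lt_of_eq_of_lt ?_ hj)
      ring
    · intro βmin _ hβ hlt
      exact hred _ fun hn0 hl ω hb hAω hNω =>
        (hrec hn0 hl ω hb hAω hNω).2 fun j hj => hlt.trans_le (hβ j hj)
  · rw [errProb, if_pos hk0] at hperr
    have hS0 : S = ∅ := Finset.card_eq_zero.mp hk0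
    rw [hk0, Nat.cast_zero, zero_add, mul_one] at hPA
    have hcover : (Set.univ : Set Ω) ⊆
        {ω | ompSupport sel (X ω) (response (X ω) β (ε ω)) (ompThreshold a p) = ∅} ∪ A := by
      intro ω _
      by_cases hω : ω ∈ A
      · exact Or.inr hω
      · exact Or.inl (Finset.subset_empty.mp (hS0 ▸ hsubset ω hω))
    have h1 := measureReal_mono (μ := P) hcover (measure_ne_top _ _)
    have h2 := measureReal_union_le (μ := P)
      {ω | ompSupport sel (X ω) (response (X ω) β (ε ω)) (ompThreshold a p) = ∅} A
    linarith
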